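/- Let $\Lambda\subset(-\infty,0]$ and $\Gamma\subset(0,\infty)$ be uniformly discrete sets (a set $S\subset\mathbb R$ is uniformly discrete if $\inf_{x,y\in S,\,x\ne y}|x-y|>0$), and assume $\sum_{\gamma\in\Gamma}\gamma^{-1/2}<\infty$. Let $(a_\lambda)_{\lambda\in\Lambda}$ and $(b_\gamma)_{\gamma\in\Gamma}$ be complex $\ell^2$ families. Then the series $$H(t)=\sum_{\lambda\in\Lambda}a_\lambda e^{2\pi i\lambda t}+\sum_{\gamma\in\Gamma}b_\gamma e^{2\pi i\gamma t}$$ converges unconditionally in $L^2(I)$ for every bounded interval $I\subset\mathbb R$ and so defines a function $H$ on $\mathbb R$ (up to null sets). If $H$ is nontrivial, then $H\notin L^2(\mathbb T,1/w)$ for every weight $w$ that is positive, increasing (not necessarily strictly) and bounded on $(0,1)$ and satisfies $\int_0^1\log w(t)\,dt=-\infty$. That is: if $\int_0^1|H(t)|^2\frac{1}{w(t)}\,dt<\infty$ for some such $w$, then $H=0$ almost everywhere on $\mathbb R$ and all the coefficients $a_\lambda$, $b_\gamma$ are zero. -/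

import Mathlib

open MeasureTheory Set Filter Topology
open scoped ENNReal

/-- A set of reals is uniformly discrete if distinct points have distance bounded below by a
positive constant (the empty set and one-point sets qualify: the infimum over no pairs is `+∞`). -/
def UniformlyDiscrete (S : Set ℝ) : Prop :=
  ∃ δ : ℝ, 0 < δ ∧ ∀ x ∈ S, ∀ y ∈ S, x ≠ y → δ ≤ |x - y|

/-- The exponential `t ↦ e^{2πiαt}`. -/
noncomputable def expo (α t : ℝ) : ℂ :=
  Complex.exp (2 * Real.pi * Complex.I * α * t)

/-- The partial sum of `∑ a_λ e^{2πiλt} + ∑ b_γ e^{2πiγt}` over the finite sets of frequencies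
`p.1 ⊆ L` and `p.2 ⊆ G`. -/
noncomputable def partialSum {L G : Set ℝ} (a : L → ℂ) (b : G → ℂ)
    (p : Finset L × Finset G) (t : ℝ) : ℂ :=
  (∑ l ∈ p.1, a l * expo l t) + ∑ g ∈ p.2, b g * expo g t

/-- `H = ∑_{λ ∈ L} a_λ e^{2πiλt} + ∑_{γ ∈ G} b_γ e^{2πiγt}`: `H` is measurable and the
finite partial sums converge to `H` (unconditionally) in `L²` on every bounded interval. -/
def IsNonharmonicSeries {L G : Set ℝ} (a : L → ℂ) (b : G → ℂ) (H : ℝ → ℂ) : Prop :=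
  AEStronglyMeasurable H volume ∧
  ∀ R : ℝ, Tendsto
    (fun p : Finset L × Finset G =>
      eLpNorm (fun t => H t - partialSum a b p t) 2 (volume.restrict (Icc (-R) R)))
    atTop (𝓝 0)

/-- The class of weights with a deep right-hand zero at the origin: `w` is positive,
(weakly) increasing and bounded on `(0,1)`, and `∫₀¹ log w = -∞`. As `log w` is bounded above on
`(0,1)`, the last condition says that the negative part of `log w` has infinite integral. -/
structure DeepZeroWeight (w : ℝ → ℝ) : Prop where
  pos : ∀ t ∈ Ioo (0 : ℝ) 1, 0 < w t
  mono : MonotoneOn w (Ioo 0 1)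
  bdd : BddAbove (w '' Ioo 0 1)
  log_integral : ∫⁻ t in Ioo (0 : ℝ) 1, ENNReal.ofReal (-Real.log (w t)) = ∞

/-- `H ∈ L²(𝕋, 1/w)`, that is `∫₀¹ |H|² / w < ∞`. -/
def MemWeightedL2 (w : ℝ → ℝ) (H : ℝ → ℂ) : Prop :=
  ∫⁻ t in Ioo (0 : ℝ) 1, ENNReal.ofReal (‖H t‖ ^ 2 / w t) < ∞

/-! Each coefficient is shown to vanish separately. Multiplying `H` by an exponential moves the
chosen frequency to 0 without changing `|H|`, and the shifted positive frequencies keep the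
square-root summability; so only the coefficient `a₀` at frequency 0 matters
(`coeff_eq_zero_of_freq_zero`).

The argument is by duality. If `h` is bounded and holomorphic slightly beyond the lower half-plane
and `μ ≤ 0`, the Poisson formula gives `∫ e^{2πiμx} h(x)/(x²+Y²) dx = (π/Y) e^{2πμY} h(-iY)`.
Applying `∏ (1 + D/γ)` to `h/(z²+Y²)`, over the positive frequencies `γ` of a finite partial sum,
removes those frequencies from the pairing and multiplies the others by `∏ (1 - μ/γ)`
(`integral_sum_mul_annih`). The partial sum thus pairs to `(π/Y) h(-iY) (a₀ + o(1))` as `Y → ∞`,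
uniformly in the partial sum.

The function `h` is `outerFactor`, an exponential of bumps times `damp`. The bumps have positive
real part only on initial intervals of `(0,1)` and carry the dyadic increments of `-log w`. On the
line the squared modulus of the exponential is at most 1 off `(0,1)` and at most `1 + w(1/2)/w` on
it, so it is controlled by `∫|H|²/w`; at `-iY` it is at least `exp(A/(240Y))`, where `A → ∞` because
`∫ log w = -∞`. The operator costs a factor `∏ (1 + A/(2πγx²))` on the line (`norm_annih_le`), which
`damp` cancels, together with the variation of `h` near `x` (`norm_annih_outerFactor_le`). The price
of `damp` at `-iY` is `exp(-10√A σ/Y)` with `σ` a multiple of `∑ γ^{-1/2}`, negligible against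
`exp(A/(240Y))`; this is where the sparsity of the positive frequencies enters.

Limits are taken in this order: `Y` is fixed so that the other nonpositive frequencies contribute
less than `|a₀|/2`; for fixed weight level `N` the partial sums tend to `H`; then `N → ∞` forces `a₀
= 0`. -/

/-! ### Pointwise bounds for the annihilating operator -/

/-- The differential operator `∏ (1 + D / γ)` over the list of frequencies `γ`, where
`D = (2πi)⁻¹ d/dz`. It is the transpose of `∏ (1 - D / γ)`, which annihilates `e^{2πiγt}`. -/
noncomputable def annih : List ℝ → (ℂ → ℂ) → ℂ → ℂ
  | [], f => f
  | γ :: l, f => fun z => annih l f z + (1 / (2 * Real.pi * Complex.I * γ)) * deriv (annih l f) z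

theorem AnalyticAt.annih {f : ℂ → ℂ} {z : ℂ} (hf : AnalyticAt ℂ f z) (l : List ℝ) :
    AnalyticAt ℂ (annih l f) z := by
  induction l with
  | nil => exact hf
  | cons γ l ih => exact ih.add (analyticAt_const.mul ih.deriv)

theorem norm_annih_coeff {γ : ℝ} (hγ : 0 < γ) :
    ‖(1 / (2 * Real.pi * Complex.I * γ) : ℂ)‖ = 1 / (2 * Real.pi * γ) := by
  simp [abs_of_pos hγ, abs_of_pos Real.pi_pos]

/-- Induction step for derivative bounds of the form `k!/r^k` at a single point: a factor `1 + c
d/dz` costs radius `c/(1+cR)` and a multiplicative constant `1+cR`, with `R` a free parameter. It is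
Bernoulli's inequality with exponent `k+1`; the prefactor `ρ/r` supplies the extra power. -/
theorem annih_growth_step {M A c R r ρ : ℝ} (hM : 0 ≤ M) (hA : 0 ≤ A) (hc : 0 ≤ c) (hR : 0 ≤ R)
    (hρ : 0 ≤ ρ) (hr : c / (1 + c * R) < r) (k : ℕ) :
    M * A * (ρ / r) * (k.factorial / r ^ k)
        + c * (M * A * (ρ / r) * ((k + 1).factorial / r ^ (k + 1)))
      ≤ M * ((1 + c * R) * A) * (ρ / (r - c / (1 + c * R)))
        * (k.factorial / (r - c / (1 + c * R)) ^ k) := by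
  have h1 : 0 < 1 + c * R := by positivity
  set c' := c / (1 + c * R) with hc'
  have hc'0 : 0 ≤ c' := by positivity
  have hcc : c = c' * (1 + c * R) := by rw [hc']; field_simp
  have hr0 : 0 < r := lt_of_le_of_lt hc'0 hr
  have hr' : 0 < r - c' := by linarith
  have hb : 1 + (k + 1 : ℕ) * (c' / (r - c')) ≤ (1 + c' / (r - c')) ^ (k + 1) :=
    one_add_mul_le_pow (le_trans (by norm_num) (by positivity : (0:ℝ) ≤ c' / (r - c'))) _
  have e1 : 1 + c' / (r - c') = r / (r - c') := by field_simp; ring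
  rw [e1] at hb
  have h2 : c' / r ≤ c' / (r - c') := by gcongr; linarith
  have h3 : 1 + c * (k + 1) / r ≤ (1 + c * R) * (r / (r - c')) ^ (k + 1) := by
    calc 1 + c * (k + 1) / r ≤ (1 + c * R) * (1 + (k + 1 : ℕ) * (c' / r)) := by
          have : (1 + c * R) * ((k + 1 : ℕ) * (c' / r)) = c * (k + 1) / r := by
            conv_rhs => rw [hcc]
            push_cast; ring
          rw [mul_add (1 + c * R), this, mul_one]
          have : 0 ≤ c * R := by positivity
          linarith
      _ ≤ _ := by
          gcongr
          refine le_trans ?_ hb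
          gcongr
  have e2 : M * A * (ρ / r) * (k.factorial / r ^ k)
        + c * (M * A * (ρ / r) * ((k + 1).factorial / r ^ (k + 1)))
      = M * A * ρ * k.factorial / r ^ (k + 1) * (1 + c * (k + 1) / r) := by
    rw [Nat.factorial_succ]; push_cast; field_simp; ring
  have e3 : M * ((1 + c * R) * A) * (ρ / (r - c')) * (k.factorial / (r - c') ^ k)
      = M * A * ρ * k.factorial / r ^ (k + 1) * ((1 + c * R) * (r / (r - c')) ^ (k + 1)) := by
    rw [div_pow, pow_succ (r - c')]; field_simp
  rw [e2, e3]
  gcongr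

theorem norm_iteratedDeriv_annih_le {f : ℂ → ℂ} {x : ℂ} (hf : AnalyticAt ℂ f x) {M ρ R : ℝ}
    (hM : 0 ≤ M) (hR : 0 ≤ R)
    (hb : ∀ k : ℕ, ‖iteratedDeriv k f x‖ ≤ M * (k.factorial / ρ ^ k)) (l : List ℝ)
    (hl : ∀ γ ∈ l, 0 < γ)
    (hρ : (l.map fun γ => 1 / (2 * Real.pi * γ) / (1 + 1 / (2 * Real.pi * γ) * R)).sum < ρ)
    (k : ℕ) :
    ‖iteratedDeriv k (annih l f) x‖ ≤ M * (l.map fun γ => 1 + 1 / (2 * Real.pi * γ) * R).prod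
      * (ρ / (ρ - (l.map fun γ => 1 / (2 * Real.pi * γ) / (1 + 1 / (2 * Real.pi * γ) * R)).sum))
      * (k.factorial /
        (ρ - (l.map fun γ => 1 / (2 * Real.pi * γ) / (1 + 1 / (2 * Real.pi * γ) * R)).sum) ^ k) := by
  induction l generalizing k with
  | nil =>
    simp only [List.map_nil, List.sum_nil] at hρ
    simpa [annih, div_self hρ.ne'] using hb k
  | cons γ l ih =>
    have hγ : 0 < γ := hl γ (by simp)
    have hl' : ∀ γ ∈ l, 0 < γ := fun g hg => hl g (by simp [hg])
    simp only [List.map_cons, List.sum_cons, List.prod_cons] at hρ ⊢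
    set c := 1 / (2 * Real.pi * γ) with hc
    have hc0 : 0 ≤ c := by positivity
    set σl := (l.map fun γ => 1 / (2 * Real.pi * γ) / (1 + 1 / (2 * Real.pi * γ) * R)).sum
    have hpos : 0 ≤ c / (1 + c * R) := by positivity
    have hσ : 0 ≤ σl := List.sum_nonneg (by
      simp only [List.mem_map]; rintro _ ⟨g, hg, rfl⟩; have := hl' g hg; positivity)
    have hA : 0 ≤ (l.map fun γ => 1 + 1 / (2 * Real.pi * γ) * R).prod := List.prod_nonneg (by
      simp only [List.mem_map]; rintro _ ⟨g, hg, rfl⟩; have := hl' g hg; positivity)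
    have ih' := ih hl' (by linarith)
    have ha := hf.annih l
    have e : iteratedDeriv k (annih (γ :: l) f) x = iteratedDeriv k (annih l f) x
        + (1 / (2 * Real.pi * Complex.I * γ)) * iteratedDeriv (k + 1) (annih l f) x := by
      rw [iteratedDeriv_succ', ← iteratedDeriv_const_mul_field, ← iteratedDeriv_fun_add]
      · rfl
      · exact ha.contDiffAt
      · exact (analyticAt_const.mul ha.deriv).contDiffAt
    rw [e]
    refine (norm_add_le _ _).trans ?_
    rw [norm_mul, norm_annih_coeff hγ, ← hc]
    have hstep := annih_growth_step hM hA hc0 hR (show 0 ≤ ρ by linarith)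
      (show c / (1 + c * R) < ρ - σl by linarith) k
    rw [sub_sub, add_comm σl] at hstep
    refine le_trans ?_ hstep
    exact add_le_add (ih' k) (mul_le_mul_of_nonneg_left (ih' (k + 1)) hc0)

/-- Cauchy's estimates start the induction at twice the total radius loss, so half the radius
survives and `ρ/(ρ-σ) = 2`. The parameter `R` will be taken to be `A/x²`. -/
theorem norm_annih_le {f : ℂ → ℂ} {x : ℂ} {M ρ R : ℝ} (hR : 0 ≤ R) (l : List ℝ) (hne : l ≠ [])
    (hl : ∀ γ ∈ l, 0 < γ)
    (hρ : ρ = 2 * (l.map fun γ => 1 / (2 * Real.pi * γ) / (1 + 1 / (2 * Real.pi * γ) * R)).sum)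
    (hf : ∀ z ∈ Metric.closedBall x ρ, AnalyticAt ℂ f z)
    (hM : ∀ z ∈ Metric.closedBall x ρ, ‖f z‖ ≤ M) :
    ‖annih l f x‖ ≤ 2 * M * (l.map fun γ => 1 + 1 / (2 * Real.pi * γ) * R).prod := by
  set σl := (l.map fun γ => 1 / (2 * Real.pi * γ) / (1 + 1 / (2 * Real.pi * γ) * R)).sum
  have hσ : 0 < σl := by
    refine List.sum_pos _ ?_ (by simpa using hne)
    simp only [List.mem_map]; rintro _ ⟨g, hg, rfl⟩; have := hl g hg; positivity
  have hρ0 : 0 < ρ := by linarith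
  have hM0 : 0 ≤ M := (norm_nonneg _).trans (hM x (Metric.mem_closedBall_self hρ0.le))
  have hb : ∀ k : ℕ, ‖iteratedDeriv k f x‖ ≤ M * (k.factorial / ρ ^ k) := by
    intro k
    have := Complex.norm_iteratedDeriv_le_of_forall_mem_sphere_norm_le (n := k) (c := x) (R := ρ)
      (C := M) (f := f) hρ0 (DifferentiableOn.diffContOnCl_ball
        (U := Metric.closedBall x ρ)
        (fun z hz => (hf z hz).differentiableAt.differentiableWithinAt) le_rfl)
      (fun z hz => hM z (Metric.sphere_subset_closedBall hz))
    calc _ ≤ _ := this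
      _ = _ := by ring
  have := norm_iteratedDeriv_annih_le (hf x (Metric.mem_closedBall_self hρ0.le)) hM0 hR hb l hl
    (by change σl < ρ; linarith) 0
  change _ ≤ _ * (ρ / (ρ - σl)) * _ at this
  have e : ρ / (ρ - σl) = 2 := by rw [hρ]; field_simp; ring
  rw [e] at this
  simp only [iteratedDeriv_zero, Nat.factorial_zero, Nat.cast_one, pow_zero, div_one, mul_one] at this
  linarith

/-! ### Decay in strips and integration by parts -/

/-- `f` is holomorphic on the strip `|Im z| < η` and is `O(1 / (1 + (Re z)²))` there. -/
def StripDecay (η : ℝ) (f : ℂ → ℂ) : Prop :=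
  DifferentiableOn ℂ f {z | |z.im| < η} ∧
    ∃ K : ℝ, 0 ≤ K ∧ ∀ z : ℂ, |z.im| < η → ‖f z‖ ≤ K / (1 + z.re ^ 2)

theorem isOpen_strip (η : ℝ) : IsOpen {z : ℂ | |z.im| < η} :=
  isOpen_lt (by fun_prop) continuous_const

theorem StripDecay.differentiableAt {η : ℝ} {f : ℂ → ℂ} (h : StripDecay η f) {z : ℂ}
    (hz : |z.im| < η) : DifferentiableAt ℂ f z :=
  h.1.differentiableAt ((isOpen_strip η).mem_nhds hz)

theorem StripDecay.deriv {η : ℝ} (hη : 0 < η) {f : ℂ → ℂ} (h : StripDecay η f) :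
    StripDecay (η / 2) (deriv f) := by
  obtain ⟨hd, K, hK, hb⟩ := h
  refine ⟨(hd.deriv (isOpen_strip η)).mono fun z hz => ?_, ?_⟩
  · simp only [mem_ofPred_eq] at hz ⊢; linarith
  -- With radius at most `1/2`, `1 + (Re z)²` at the centre is at most twice its value anywhere in
  -- the disc.
  set ε := min (η / 2) (1 / 2) with hε
  have hε0 : 0 < ε := by positivity
  have hε1 : ε ≤ η / 2 := min_le_left _ _
  have hε2 : ε ≤ 1 / 2 := min_le_right _ _
  refine ⟨2 * K / ε, by positivity, fun z hz => ?_⟩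
  have hin : ∀ w ∈ Metric.closedBall z ε, |w.im| < η := by
    intro w hw
    have h1 : |(w - z).im| ≤ ε := (Complex.abs_im_le_norm _).trans (by simpa [dist_eq_norm] using hw)
    have h2 : |w.im| ≤ |(w - z).im| + |z.im| := by
      have := abs_add_le (w - z).im z.im
      simpa using this
    linarith
  have := Complex.norm_deriv_le_of_forall_mem_sphere_norm_le (c := z) (R := ε) (f := f)
    (C := 2 * K / (1 + z.re ^ 2)) hε0
    (DifferentiableOn.diffContOnCl_ball hd fun w hw => hin w hw) ?_
  · refine this.trans (le_of_eq ?_)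
    field_simp
  · intro w hw
    have hw' := Metric.sphere_subset_closedBall hw
    refine (hb w (hin w hw')).trans ?_
    rw [div_le_div_iff₀ (by positivity) (by positivity)]
    have h1 : |(w - z).re| ≤ 1 / 2 :=
      ((Complex.abs_re_le_norm _).trans (by simpa [dist_eq_norm] using hw')).trans hε2
    rw [Complex.sub_re] at h1
    have h3 := abs_le.1 h1
    have : 1 + z.re ^ 2 ≤ 2 * (1 + w.re ^ 2) := by nlinarith [sq_nonneg (w.re + (w.re - z.re))]
    nlinarith

theorem StripDecay.mono {η η' : ℝ} {f : ℂ → ℂ} (h : StripDecay η f) (hle : η' ≤ η) :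
    StripDecay η' f := by
  obtain ⟨hd, K, hK, hb⟩ := h
  exact ⟨hd.mono fun z hz => lt_of_lt_of_le hz hle, K, hK, fun z hz => hb z (hz.trans_le hle)⟩

theorem StripDecay.annih {η : ℝ} (hη : 0 < η) {f : ℂ → ℂ} (h : StripDecay η f) (l : List ℝ) :
    ∃ η' > 0, StripDecay η' (annih l f) := by
  induction l with
  | nil => exact ⟨η, hη, h⟩
  | cons γ l ih =>
    obtain ⟨η', hη', h'⟩ := ih
    have hd := h'.deriv hη'
    have hm := h'.mono (show η' / 2 ≤ η' by linarith)
    refine ⟨η' / 2, by positivity, hm.1.add (hd.1.const_mul _), ?_⟩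
    obtain ⟨-, K, hK, hb⟩ := hm
    obtain ⟨-, K', hK', hb'⟩ := hd
    refine ⟨K + ‖(1 / (2 * Real.pi * Complex.I * γ) : ℂ)‖ * K', by positivity, fun z hz => ?_⟩
    refine (norm_add_le _ _).trans ?_
    rw [norm_mul, add_div, mul_div_assoc]
    gcongr
    · exact hb z hz
    · exact hb' z hz

theorem StripDecay.continuous {η : ℝ} (hη : 0 < η) {f : ℂ → ℂ} (h : StripDecay η f) :
    Continuous fun x : ℝ => f x :=
  continuous_iff_continuousAt.2 fun x =>
    (h.differentiableAt (z := (x : ℂ)) (by simpa using hη)).continuousAt.comp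
      Complex.continuous_ofReal.continuousAt

theorem StripDecay.integrable {η : ℝ} (hη : 0 < η) {f : ℂ → ℂ} (h : StripDecay η f) :
    Integrable fun x : ℝ => f x := by
  obtain ⟨K, hK, hb⟩ := h.2
  refine (integrable_inv_one_add_sq.const_mul K).mono' (h.continuous hη).aestronglyMeasurable
    (Eventually.of_forall fun x => ?_)
  simpa [div_eq_mul_inv] using hb x (by simpa using hη)

theorem norm_expo (α t : ℝ) : ‖expo α t‖ = 1 := by
  have : (2 * Real.pi * Complex.I * α * t : ℂ) = ((2 * Real.pi * α * t : ℝ) : ℂ) * Complex.I := by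
    push_cast; ring
  rw [expo, this, Complex.norm_exp_ofReal_mul_I]

theorem hasDerivAt_expo (α t : ℝ) :
    HasDerivAt (expo α) (2 * Real.pi * Complex.I * α * expo α t) t := by
  have h : HasDerivAt (fun z : ℂ => Complex.exp (2 * Real.pi * Complex.I * α * z))
      (Complex.exp (2 * Real.pi * Complex.I * α * t) * (2 * Real.pi * Complex.I * α)) (t : ℂ) := by
    have := ((hasDerivAt_id (t : ℂ)).const_mul (2 * Real.pi * Complex.I * α : ℂ)).cexp
    simp only [mul_one] at this
    exact this
  exact h.comp_ofReal.congr_deriv (mul_comm (Complex.exp _) _)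

theorem continuous_expo (α : ℝ) : Continuous (expo α) :=
  continuous_iff_continuousAt.2 fun t => (hasDerivAt_expo α t).continuousAt

theorem integrable_expo_mul {f : ℝ → ℂ} (hf : Integrable f) (α : ℝ) :
    Integrable fun x => expo α x * f x :=
  hf.bdd_mul (c := 1) (continuous_expo α).aestronglyMeasurable
    (Eventually.of_forall fun x => (norm_expo α x).le)

/-- Integration by parts moves each factor `1 + D/γ` onto the exponential, where it acts as the
scalar `1 - μ/γ`. -/
theorem integral_expo_mul_annih {η : ℝ} (hη : 0 < η) {f : ℂ → ℂ} (h : StripDecay η f) (μ : ℝ)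
    (l : List ℝ) (hl : ∀ γ ∈ l, 0 < γ) :
    ∫ x : ℝ, expo μ x * annih l f x
      = (l.map fun γ : ℝ => (1 - μ / γ : ℂ)).prod * ∫ x : ℝ, expo μ x * f x := by
  induction l with
  | nil => simp [annih]
  | cons γ l ih =>
    have hγ : (γ : ℂ) ≠ 0 := by exact_mod_cast (hl γ (by simp)).ne'
    have ih' := ih fun g hg => hl g (by simp [hg])
    obtain ⟨η', hη', h'⟩ := h.annih hη l
    have i1 := h'.integrable hη'
    have hd := h'.deriv hη'
    have i2 := hd.integrable (by positivity)
    have ibp := integral_mul_deriv_eq_deriv_mul_of_integrable (u := expo μ)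
      (v := fun x : ℝ => annih l f x) (u' := fun x => 2 * Real.pi * Complex.I * μ * expo μ x)
      (v' := fun x : ℝ => deriv (annih l f) x) (fun x _ => hasDerivAt_expo μ x)
      (fun x _ => (h'.differentiableAt (z := (x : ℂ)) (by simpa using hη')).hasDerivAt.comp_ofReal)
      (integrable_expo_mul i2 μ)
      (by
        have := (integrable_expo_mul i1 μ).const_mul (2 * Real.pi * Complex.I * μ : ℂ)
        refine this.congr (Eventually.of_forall fun x => ?_)
        simp only [Pi.mul_apply]; ring)
      (integrable_expo_mul i1 μ)
    have e1 : ∫ x : ℝ, expo μ x * annih (γ :: l) f x = (∫ x : ℝ, expo μ x * annih l f x)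
        + (1 / (2 * Real.pi * Complex.I * γ)) * ∫ x : ℝ, expo μ x * deriv (annih l f) x := by
      rw [← integral_const_mul, ← integral_add (integrable_expo_mul i1 μ)
        ((integrable_expo_mul i2 μ).const_mul _)]
      congr 1; ext x; simp only [annih]; ring
    have e2 : ∫ x : ℝ, 2 * Real.pi * Complex.I * μ * expo μ x * annih l f x
        = 2 * Real.pi * Complex.I * μ * ∫ x : ℝ, expo μ x * annih l f x := by
      rw [← integral_const_mul]; congr 1; ext x; ring
    rw [e1, ibp, e2, ih', List.map_cons, List.prod_cons]
    have hpi : (Real.pi : ℂ) ≠ 0 := by exact_mod_cast Real.pi_ne_zero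
    have hI := Complex.I_ne_zero
    field_simp
    ring

/-! ### Poisson formula for bounded functions in the lower half-plane -/

theorem integral_eq_zero_of_decay {η : ℝ} (hη : 0 < η) {F : ℂ → ℂ} {K Y : ℝ} (hK : 0 ≤ K)
    (hY : 0 < Y) (hF : DifferentiableOn ℂ F {z | z.im < η}) (hint : Integrable fun x : ℝ => F x)
    (hb : ∀ z : ℂ, z.im < η → Y < ‖z‖ → ‖F z‖ ≤ K / (‖z‖ - Y) ^ 2) :
    ∫ x : ℝ, F x = 0 := by
  have hlim : Tendsto (fun R : ℝ => ∫ x in (-R)..R, F x) atTop (𝓝 (∫ x : ℝ, F x)) :=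
    intervalIntegral_tendsto_integral hint tendsto_neg_atTop_atBot tendsto_id
  refine tendsto_nhds_unique hlim ?_
  have hz : Tendsto (fun R : ℝ => 4 * K * (R / (R - Y) ^ 2)) atTop (𝓝 (4 * K * 0)) := by
    refine Tendsto.const_mul _ ?_
    have h1 : Tendsto (fun R : ℝ => 4 * R⁻¹) atTop (𝓝 (4 * 0)) :=
      tendsto_inv_atTop_zero.const_mul 4
    rw [mul_zero] at h1
    refine squeeze_zero' ?_ ?_ h1
    · filter_upwards [eventually_ge_atTop 0] with R hR
      positivity
    · filter_upwards [eventually_gt_atTop (2 * Y)] with R hR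
      have h2 : 0 < R - Y := by linarith
      have h3 : 0 < R := by linarith
      rw [← div_eq_mul_inv, div_le_div_iff₀ (by positivity) h3]
      nlinarith
  rw [mul_zero] at hz
  refine squeeze_zero_norm' ?_ hz
  filter_upwards [eventually_gt_atTop Y] with R hR
  have hR0 : 0 < R := hY.trans hR
  have hRY : 0 < R - Y := by linarith
  -- Cauchy's theorem on `[-R, R] × [-R, 0]`. The three sides off the real line have total length
  -- `4R`, and the integrand there is `O(R⁻²)`.
  have hrect := Complex.integral_boundary_rect_eq_zero_of_differentiableOn F
    (⟨-R, -R⟩ : ℂ) (⟨R, 0⟩ : ℂ) (hF.mono (by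
      intro z hz
      have h1 := hz.2
      simp only [mem_preimage] at h1
      rw [uIcc_of_le (by linarith)] at h1
      exact lt_of_le_of_lt h1.2 hη))
  simp only [Complex.ofReal_zero, zero_mul, add_zero] at hrect
  have hbd : ∀ z : ℂ, z.im ≤ 0 → R ≤ ‖z‖ → ‖F z‖ ≤ K / (R - Y) ^ 2 := by
    intro z h1 h2
    refine (hb z (h1.trans_lt hη) (hR.trans_le h2)).trans ?_
    gcongr
  have b1 : ‖∫ x : ℝ in (-R)..R, F (x + (-R : ℝ) * Complex.I)‖ ≤ K / (R - Y) ^ 2 * |R - -R| := by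
    refine intervalIntegral.norm_integral_le_of_norm_le_const fun x _ => hbd _ ?_ ?_
    · simpa using hR0.le
    · have := Complex.abs_im_le_norm (x + (-R : ℝ) * Complex.I)
      simp only [Complex.add_im, Complex.ofReal_im, Complex.mul_im, Complex.ofReal_re,
        Complex.I_im, mul_one, Complex.I_re, mul_zero, add_zero, zero_add, abs_neg,
        abs_of_pos hR0] at this
      exact this
  have b2 : ∀ s : ℝ, |s| = R →
      ‖∫ y : ℝ in (-R)..0, F (s + y * Complex.I)‖ ≤ K / (R - Y) ^ 2 * |0 - -R| := by
    intro s hs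
    refine intervalIntegral.norm_integral_le_of_norm_le_const fun y hy => hbd _ ?_ ?_
    · rw [uIoc_of_le (by linarith)] at hy
      simpa using hy.2
    · have := Complex.abs_re_le_norm (s + y * Complex.I)
      simpa [hs] using this
  have b3 := b2 R (abs_of_pos hR0)
  have b4 := b2 (-R) (by rw [abs_neg, abs_of_pos hR0])
  rw [sub_neg_eq_add, abs_of_pos (by linarith)] at b1
  rw [zero_sub, neg_neg, abs_of_pos hR0] at b3 b4
  have e : (∫ x in (-R)..R, F x) = (∫ x : ℝ in (-R)..R, F (x + (-R : ℝ) * Complex.I))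
      + (Complex.I • ∫ y : ℝ in (-R)..0, F ((R : ℝ) + y * Complex.I))
      - Complex.I • ∫ y : ℝ in (-R)..0, F ((-R : ℝ) + y * Complex.I) := by
    linear_combination -hrect
  rw [e]
  refine (norm_sub_le _ _).trans ((add_le_add_left (norm_add_le _ _) _).trans ?_)
  rw [norm_smul, norm_smul, Complex.norm_I, one_mul, one_mul]
  calc _ ≤ K / (R - Y) ^ 2 * (R + R) + K / (R - Y) ^ 2 * R + K / (R - Y) ^ 2 * R := by
        gcongr
    _ = _ := by ring

theorem integral_univ_inv_sq_add_sq {Y : ℝ} (hY : 0 < Y) :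
    ∫ x : ℝ, 1 / (x ^ 2 + Y ^ 2) = Real.pi / Y := by
  have h := Measure.integral_comp_mul_left (fun x : ℝ => (1 + x ^ 2)⁻¹) Y⁻¹
  rw [integral_univ_inv_one_add_sq, inv_inv, abs_of_pos hY, smul_eq_mul] at h
  have : (fun x : ℝ => 1 / (x ^ 2 + Y ^ 2)) = fun x => (Y ^ 2)⁻¹ * (1 + (Y⁻¹ * x) ^ 2)⁻¹ := by
    ext x
    field_simp
    ring
  rw [this, integral_const_mul, h]
  field_simp

theorem integrable_of_norm_le_div {Y : ℝ} (hY : 0 < Y) {f : ℝ → ℂ} (hf : Continuous f) {K : ℝ}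
    (hb : ∀ x, ‖f x‖ ≤ K) : Integrable fun x : ℝ => f x / ((x : ℂ) ^ 2 + (Y : ℂ) ^ 2) := by
  have hne : ∀ x : ℝ, (x : ℂ) ^ 2 + (Y : ℂ) ^ 2 ≠ 0 := fun x => by
    have : x ^ 2 + Y ^ 2 ≠ 0 := by positivity
    exact_mod_cast this
  have hint : Integrable fun x : ℝ => K * (1 / (x ^ 2 + Y ^ 2)) := by
    refine Integrable.const_mul ?_ _
    have := (integrable_inv_one_add_sq.comp_mul_left' (inv_ne_zero hY.ne')).const_mul ((Y ^ 2)⁻¹)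
    refine this.congr (Eventually.of_forall fun x => ?_)
    simp only
    field_simp
    ring
  refine hint.mono' (Continuous.aestronglyMeasurable (by fun_prop (disch := exact hne _)))
    (Eventually.of_forall fun x => ?_)
  have : ‖(x : ℂ) ^ 2 + (Y : ℂ) ^ 2‖ = x ^ 2 + Y ^ 2 := by
    rw [← Complex.ofReal_pow, ← Complex.ofReal_pow, ← Complex.ofReal_add, Complex.norm_real,
      Real.norm_of_nonneg (by positivity)]
  rw [norm_div, this, mul_one_div]
  gcongr
  exact hb x

/-- The Poisson formula for the lower half-plane at the point `-iY`. -/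
theorem integral_lowerHalfPlane_poisson {η : ℝ} (hη : 0 < η) {h : ℂ → ℂ} {K Y : ℝ} (hY : η ≤ Y)
    (hh : DifferentiableOn ℂ h {z | z.im < η}) (hb : ∀ z : ℂ, z.im < η → ‖h z‖ ≤ K) :
    ∫ x : ℝ, h x / ((x : ℂ) ^ 2 + (Y : ℂ) ^ 2) = Real.pi / Y * h (-(Y * Complex.I)) := by
  have hY0 : 0 < Y := hη.trans_le hY
  set z₀ : ℂ := -(Y * Complex.I) with hz₀
  have hopen : IsOpen {z : ℂ | z.im < η} := isOpen_lt (by fun_prop) continuous_const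
  have hz₀mem : z₀ ∈ {z : ℂ | z.im < η} := by simp [hz₀]; linarith
  have hsq : ∀ z : ℂ, (z - z₀) * (z + z₀) = z ^ 2 + (Y : ℂ) ^ 2 := by
    intro z; rw [hz₀]; ring_nf; rw [Complex.I_sq]; ring
  have hK : 0 ≤ K := (norm_nonneg _).trans (hb z₀ hz₀mem)
  have hz₀norm : ‖z₀‖ = Y := by simp [hz₀, abs_of_pos hY0]
  -- This is `(h(z) - h(z₀))/(z² + Y²)` with the singularity at `z₀ = -iY` removed; the remaining
  -- pole `iY` lies outside `Im z < η` because `η ≤ Y`.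
  set F : ℂ → ℂ := fun z => dslope h z₀ z / (z + z₀) with hFdef
  have hF : ∀ z, z ≠ z₀ → F z = (h z - h z₀) / (z ^ 2 + (Y : ℂ) ^ 2) := by
    intro z hz
    rw [hFdef]
    simp only
    rw [dslope_of_ne _ hz, slope_def_field, div_div, hsq]
  have hreal : ∀ x : ℝ, (x : ℂ) ≠ z₀ := by
    intro x hx
    have := congrArg Complex.im hx
    simp [hz₀] at this
    linarith
  have hcont : Continuous fun x : ℝ => h x := continuous_iff_continuousAt.2 fun x =>
    (hh.differentiableAt (hopen.mem_nhds (by simpa using hη))).continuousAt.comp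
      Complex.continuous_ofReal.continuousAt
  have i1 := integrable_of_norm_le_div hY0 hcont (K := K) fun x => hb x (by simpa using hη)
  have i2 := integrable_of_norm_le_div hY0 (continuous_const (y := h z₀)) (K := K)
    fun _ => hb z₀ hz₀mem
  have hFreal : (fun x : ℝ => F x) = fun x : ℝ =>
      h x / ((x : ℂ) ^ 2 + (Y : ℂ) ^ 2) - h z₀ / ((x : ℂ) ^ 2 + (Y : ℂ) ^ 2) := by
    ext x; rw [hF _ (hreal x), sub_div]
  have hzero : ∫ x : ℝ, F x = 0 := by
    refine integral_eq_zero_of_decay hη (K := 2 * K) (by positivity) hY0 ?_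
      (by rw [hFreal]; exact i1.sub i2) ?_
    · refine ((Complex.differentiableOn_dslope (hopen.mem_nhds hz₀mem)).2 hh).div (by fun_prop) ?_
      intro z hz h0
      have := congrArg Complex.im h0
      simp [hz₀] at this
      simp only [mem_ofPred_eq] at hz
      linarith
    · intro z hz hzY
      have hne : z ≠ z₀ := by rintro rfl; rw [hz₀norm] at hzY; exact lt_irrefl _ hzY
      have hpos : 0 < ‖z‖ - Y := by linarith
      rw [hF z hne, norm_div, ← hsq, norm_mul]
      have n1 : ‖z‖ - Y ≤ ‖z - z₀‖ := by rw [← hz₀norm]; exact norm_sub_norm_le _ _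
      have n2 : ‖z‖ - Y ≤ ‖z + z₀‖ := by
        rw [← hz₀norm, ← norm_neg z₀, ← sub_neg_eq_add]; exact norm_sub_norm_le _ _
      rw [sq]
      gcongr
      refine (norm_sub_le _ _).trans ?_
      have := hb z hz
      have := hb z₀ hz₀mem
      linarith
  rw [hFreal, integral_sub i1 i2, sub_eq_zero] at hzero
  rw [hzero]
  have e : ∫ x : ℝ, h z₀ / ((x : ℂ) ^ 2 + (Y : ℂ) ^ 2)
      = h z₀ * ((∫ x : ℝ, 1 / (x ^ 2 + Y ^ 2) : ℝ) : ℂ) := by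
    rw [← integral_complex_ofReal, ← integral_const_mul]
    congr 1; ext x; push_cast; ring
  rw [e, integral_univ_inv_sq_add_sq hY0]
  push_cast
  ring

/-- `h` is bounded and holomorphic on a half-plane `Im z < η` with `η > 0`. -/
def BddHalfPlane (h : ℂ → ℂ) : Prop :=
  ∃ η : ℝ, 0 < η ∧ DifferentiableOn ℂ h {z | z.im < η} ∧ ∃ K : ℝ, ∀ z : ℂ, z.im < η → ‖h z‖ ≤ K

theorem BddHalfPlane.const (c : ℂ) : BddHalfPlane fun _ => c :=
  ⟨1, one_pos, differentiableOn_const _, ‖c‖, fun _ _ => le_rfl⟩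

theorem BddHalfPlane.add {f g : ℂ → ℂ} (hf : BddHalfPlane f) (hg : BddHalfPlane g) :
    BddHalfPlane fun z => f z + g z := by
  obtain ⟨η, hη, hd, K, hK⟩ := hf
  obtain ⟨η', hη', hd', K', hK'⟩ := hg
  refine ⟨min η η', lt_min hη hη', ?_, K + K', fun z hz => ?_⟩
  · exact (hd.mono fun z (hz : z.im < min η η') =>
      show z.im < η from hz.trans_le (min_le_left _ _)).add (hd'.mono fun z (hz : z.im < min η η') =>
      show z.im < η' from hz.trans_le (min_le_right _ _))
  · exact (norm_add_le _ _).trans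
      (add_le_add (hK z (lt_min_iff.1 hz).1) (hK' z (lt_min_iff.1 hz).2))

theorem BddHalfPlane.mul {f g : ℂ → ℂ} (hf : BddHalfPlane f) (hg : BddHalfPlane g) :
    BddHalfPlane fun z => f z * g z := by
  obtain ⟨η, hη, hd, K, hK⟩ := hf
  obtain ⟨η', hη', hd', K', hK'⟩ := hg
  refine ⟨min η η', lt_min hη hη', ?_, K * K', fun z hz => ?_⟩
  · exact (hd.mono fun z (hz : z.im < min η η') =>
      show z.im < η from hz.trans_le (min_le_left _ _)).mul (hd'.mono fun z (hz : z.im < min η η') =>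
      show z.im < η' from hz.trans_le (min_le_right _ _))
  · rw [norm_mul]
    exact mul_le_mul (hK z (lt_min_iff.1 hz).1) (hK' z (lt_min_iff.1 hz).2) (norm_nonneg _)
      ((norm_nonneg _).trans (hK z (lt_min_iff.1 hz).1))

theorem BddHalfPlane.pow {f : ℂ → ℂ} (hf : BddHalfPlane f) (n : ℕ) :
    BddHalfPlane fun z => f z ^ n := by
  induction n with
  | zero => simpa using BddHalfPlane.const 1
  | succ n ih => simpa only [pow_succ] using ih.mul hf

theorem BddHalfPlane.cexp {f : ℂ → ℂ} (hf : BddHalfPlane f) :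
    BddHalfPlane fun z => Complex.exp (f z) := by
  obtain ⟨η, hη, hd, K, hK⟩ := hf
  refine ⟨η, hη, hd.cexp, Real.exp K, fun z hz => ?_⟩
  rw [Complex.norm_exp]
  exact Real.exp_le_exp.2 ((Complex.re_le_norm _).trans (hK z hz))

theorem BddHalfPlane.sum {ι : Type*} (s : Finset ι) {f : ι → ℂ → ℂ}
    (hf : ∀ i ∈ s, BddHalfPlane (f i)) : BddHalfPlane fun z => ∑ i ∈ s, f i z := by
  classical
  induction s using Finset.induction_on with
  | empty => simpa using BddHalfPlane.const 0
  | insert a s ha ih =>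
    simp only [Finset.sum_insert ha]
    exact (hf a (by simp)).add (ih fun i hi => hf i (by simp [hi]))

/-! ### The bump functions -/

/-- A rational function with its pole at `s(2+i)`, whose real part on the real line is positive
on `(0, 4s)` and nonpositive elsewhere. -/
noncomputable def bump (s : ℝ) (z : ℂ) : ℂ :=
  -(Complex.I * s) / (z - s * (2 + Complex.I)) - 5 / 3 * s ^ 2 / (z - s * (2 + Complex.I)) ^ 2

/-- With `u = x - 2s`, the numerator is `s²((u² + s²) - 5/3 (u² - s²))`; the coefficient `5/3` is
what places its zeros at `u = ±2s`, that is, at `x = 0` and `x = 4s`. -/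
theorem bump_re_ofReal {s : ℝ} (hs : 0 < s) (x : ℝ) :
    (bump s x).re = 2 / 3 * s ^ 2 * (x * (4 * s - x)) / ((x - 2 * s) ^ 2 + s ^ 2) ^ 2 := by
  have hne : ((x - 2 * s) ^ 2 + s ^ 2 : ℝ) ≠ 0 := by positivity
  have hne' : (((x - 2 * s) ^ 2 + s ^ 2 : ℝ) : ℂ) ≠ 0 := by exact_mod_cast hne
  have h : (x - s * (2 + Complex.I) : ℂ) * ((x - 2 * s : ℝ) + s * Complex.I)
      = (((x - 2 * s) ^ 2 + s ^ 2 : ℝ) : ℂ) := by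
    push_cast; ring_nf; rw [Complex.I_sq]; ring
  have h0 : (x - s * (2 + Complex.I) : ℂ) ≠ 0 := by
    intro h0; rw [h0, zero_mul] at h; exact hne' h.symm
  have hinv : (x - s * (2 + Complex.I) : ℂ)⁻¹
      = ((x - 2 * s : ℝ) + s * Complex.I) / (((x - 2 * s) ^ 2 + s ^ 2 : ℝ) : ℂ) := by
    rw [eq_div_iff hne', ← h]; field_simp
  have e : bump s x = ((2 / 3 * s ^ 2 * (x * (4 * s - x)) / ((x - 2 * s) ^ 2 + s ^ 2) ^ 2 : ℝ) : ℂ)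
      + ((-(s * (x - 2 * s)) / ((x - 2 * s) ^ 2 + s ^ 2)
        - 5 / 3 * s ^ 2 * (2 * (x - 2 * s) * s) / ((x - 2 * s) ^ 2 + s ^ 2) ^ 2 : ℝ) : ℂ)
        * Complex.I := by
    rw [bump, div_eq_mul_inv, div_eq_mul_inv, ← inv_pow, hinv, div_pow]
    have hne2 : ((x - 2 * s : ℂ) ^ 2 + s ^ 2) ≠ 0 := by exact_mod_cast hne
    push_cast
    field_simp
    ring_nf
    rw [Complex.I_sq]
    ring
  rw [e]
  simp only [Complex.add_re, Complex.ofReal_re, Complex.re_ofReal_mul, Complex.I_re, mul_zero,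
    add_zero]

theorem bump_re_nonpos {s : ℝ} (hs : 0 < s) {x : ℝ} (hx : x ≤ 0 ∨ 4 * s ≤ x) :
    (bump s x).re ≤ 0 := by
  rw [bump_re_ofReal hs]
  refine div_nonpos_of_nonpos_of_nonneg (mul_nonpos_of_nonneg_of_nonpos (by positivity) ?_)
    (by positivity)
  rcases hx with hx | hx
  · exact mul_nonpos_of_nonpos_of_nonneg hx (by linarith)
  · exact mul_nonpos_of_nonneg_of_nonpos (by linarith) (by linarith)

theorem bump_re_le {s : ℝ} (hs : 0 < s) (x : ℝ) : (bump s x).re ≤ 8 / 3 := by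
  rw [bump_re_ofReal hs, div_le_iff₀ (by positivity)]
  have : x * (4 * s - x) = 4 * s ^ 2 - (x - 2 * s) ^ 2 := by ring
  rw [this]
  nlinarith [sq_nonneg ((x - 2 * s) ^ 2), sq_nonneg ((x - 2 * s) * s)]

/-- Far from the pole the first term dominates, being about `-is/(-iY) = s/Y`; the double pole
contributes a nonnegative amount because `Y + s ≥ 2s`. -/
theorem bump_re_neg_I {s Y : ℝ} (hs : 0 < s) (hY : s ≤ Y) :
    s / (4 * Y) ≤ (bump s (-(Y * Complex.I))).re := by
  have hY0 : 0 < Y := hs.trans_le hY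
  set D : ℝ := 4 * s ^ 2 + (Y + s) ^ 2 with hD
  have hD0 : 0 < D := by positivity
  have hD' : (D : ℂ) ≠ 0 := by exact_mod_cast hD0.ne'
  have h : (-(Y * Complex.I) - s * (2 + Complex.I) : ℂ) * (-(2 * s) + (Y + s) * Complex.I)
      = (D : ℂ) := by
    rw [hD]; push_cast; ring_nf; rw [Complex.I_sq]; ring
  have h0 : (-(Y * Complex.I) - s * (2 + Complex.I) : ℂ) ≠ 0 := by
    intro h0; rw [h0, zero_mul] at h; exact hD' h.symm
  have hinv : (-(Y * Complex.I) - s * (2 + Complex.I) : ℂ)⁻¹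
      = (-(2 * s) + (Y + s) * Complex.I) / (D : ℂ) := by
    rw [eq_div_iff hD', ← h]; field_simp
  have e : bump s (-(Y * Complex.I))
      = ((s * (Y + s) / D + 5 / 3 * s ^ 2 * ((Y + s) ^ 2 - 4 * s ^ 2) / D ^ 2 : ℝ) : ℂ)
      + ((2 * s ^ 2 / D + 5 / 3 * s ^ 2 * (4 * s * (Y + s)) / D ^ 2 : ℝ) : ℂ) * Complex.I := by
    rw [bump, div_eq_mul_inv, div_eq_mul_inv, ← inv_pow, hinv, div_pow]
    push_cast
    field_simp
    ring_nf
    rw [Complex.I_sq]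
    ring
  rw [e]
  simp only [Complex.add_re, Complex.ofReal_re, Complex.re_ofReal_mul, Complex.I_re, mul_zero,
    add_zero]
  have h1 : s / (4 * Y) ≤ s * (Y + s) / D := by
    rw [div_le_div_iff₀ (by positivity) hD0, hD]
    have : 4 * s ^ 2 + (Y + s) ^ 2 ≤ (Y + s) * (4 * Y) := by nlinarith
    nlinarith
  have h2 : 0 ≤ 5 / 3 * s ^ 2 * ((Y + s) ^ 2 - 4 * s ^ 2) / D ^ 2 := by
    have : 0 ≤ (Y + s) ^ 2 - 4 * s ^ 2 := by nlinarith
    positivity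
  linarith

theorem bddHalfPlane_bump {s : ℝ} (hs : 0 < s) : BddHalfPlane (bump s) := by
  have him : ∀ z : ℂ, z.im < s / 2 → s / 2 ≤ ‖z - s * (2 + Complex.I)‖ := by
    intro z hz
    refine le_trans ?_ (Complex.abs_im_le_norm _)
    simp only [Complex.sub_im, Complex.mul_im, Complex.ofReal_re, Complex.add_im, Complex.I_im,
      Complex.ofReal_im, zero_mul, add_zero]
    rw [abs_sub_comm]
    refine le_trans ?_ (le_abs_self _)
    norm_num
    linarith
  refine ⟨s / 2, by positivity, ?_, 2 + 20 / 3, fun z hz => ?_⟩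
  · intro z hz
    have hne : z - s * (2 + Complex.I) ≠ 0 := norm_pos_iff.1 (lt_of_lt_of_le (by positivity) (him z hz))
    refine DifferentiableAt.differentiableWithinAt ?_
    unfold bump
    fun_prop (disch := simpa using hne)
  · have h := him z hz
    refine (norm_sub_le _ _).trans (add_le_add ?_ ?_)
    · rw [norm_div, norm_neg, norm_mul, Complex.norm_I, one_mul, Complex.norm_real,
        Real.norm_of_nonneg hs.le, div_le_iff₀ (by linarith)]
      linarith
    · rw [norm_div, norm_mul, norm_pow, norm_pow, Complex.norm_real, Real.norm_of_nonneg hs.le,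
        div_le_iff₀ (pow_pos (lt_of_lt_of_le (by positivity) h) 2)]
      have : (s / 2) ^ 2 ≤ ‖z - s * (2 + Complex.I)‖ ^ 2 := by gcongr
      norm_num
      linarith

/-- The pole is at distance at least `|x|/√5` and at least `s` from a real point `x`, which makes
the derivative of size `s/x²` on the disc. -/
theorem bump_sub_le {s x ρ : ℝ} (hs : 0 < s) {ζ : ℂ} (hρ : ‖ζ - x‖ ≤ ρ)
    (hρx : ρ ≤ |x| / 20) (hx : x ≠ 0) : ‖bump s ζ - bump s x‖ ≤ 60 * s * ρ / x ^ 2 := by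
  have hρ0 : 0 ≤ ρ := (norm_nonneg (ζ - x)).trans hρ
  have hx2 : 0 < x ^ 2 := by positivity
  have hxa : 0 < |x| := abs_pos.2 hx
  set v : ℂ := x - s * (2 + Complex.I) with hv
  set u : ℂ := ζ - s * (2 + Complex.I) with hu
  have huv : u - v = ζ - x := by rw [hu, hv]; ring
  have hvn : ‖v‖ ^ 2 = (x - 2 * s) ^ 2 + s ^ 2 := by
    rw [Complex.sq_norm, Complex.normSq_apply, hv]
    simp
    ring
  have hv1 : x ^ 2 ≤ 5 * ‖v‖ ^ 2 := by rw [hvn]; nlinarith [sq_nonneg (2 * x - 5 * s)]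
  have hv2 : s ≤ ‖v‖ := by
    refine (sq_le_sq₀ hs.le (norm_nonneg v)).1 ?_
    rw [hvn]; nlinarith [sq_nonneg (x - 2 * s)]
  have hv0 : 0 < ‖v‖ := hs.trans_le hv2
  have hv3 : |x| ≤ 3 * ‖v‖ := by
    refine (sq_le_sq₀ hxa.le (by positivity)).1 ?_
    rw [sq_abs]; nlinarith
  have hu1 : ‖v‖ / 2 ≤ ‖u‖ := by
    have : ‖v‖ - ‖u‖ ≤ ‖ζ - x‖ := by
      rw [← huv, norm_sub_rev u v]; exact norm_sub_norm_le v u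
    linarith
  have hu0 : 0 < ‖u‖ := by linarith
  have hvne : v ≠ 0 := norm_pos_iff.1 hv0
  have hune : u ≠ 0 := norm_pos_iff.1 hu0
  have e : bump s ζ - bump s x
      = Complex.I * s * (u - v) / (u * v)
        + 5 / 3 * s ^ 2 * (u - v) * (1 / (u * v ^ 2) + 1 / (u ^ 2 * v)) := by
    rw [bump, bump, ← hu, ← hv]
    field_simp
    ring
  have i1 : 1 / ‖u‖ ≤ 2 / ‖v‖ := by
    rw [div_le_div_iff₀ hu0 hv0]; linarith
  have iv : s / ‖v‖ ≤ 1 := (div_le_one hv0).2 hv2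
  have t1 : ‖Complex.I * s * (u - v) / (u * v)‖ ≤ 2 * (s * ρ / ‖v‖ ^ 2) := by
    rw [norm_div, norm_mul, norm_mul, norm_mul, Complex.norm_I, one_mul, Complex.norm_real,
      Real.norm_of_nonneg hs.le, huv]
    calc s * ‖ζ - x‖ / (‖u‖ * ‖v‖) = s * ‖ζ - x‖ * (1 / ‖u‖) * (1 / ‖v‖) := by field_simp
      _ ≤ s * ρ * (2 / ‖v‖) * (1 / ‖v‖) := by gcongr
      _ = _ := by field_simp
  have t2 : ‖5 / 3 * s ^ 2 * (u - v) * (1 / (u * v ^ 2) + 1 / (u ^ 2 * v))‖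
      ≤ 10 * (s * ρ / ‖v‖ ^ 2) := by
    rw [norm_mul, norm_mul, norm_mul, norm_pow, Complex.norm_real, Real.norm_of_nonneg hs.le, huv]
    have : ‖1 / (u * v ^ 2) + 1 / (u ^ 2 * v)‖ ≤ 6 * (1 / ‖v‖) ^ 3 := by
      refine (norm_add_le _ _).trans ?_
      rw [norm_div, norm_div, norm_mul, norm_mul, norm_pow, norm_pow, norm_one]
      calc 1 / (‖u‖ * ‖v‖ ^ 2) + 1 / (‖u‖ ^ 2 * ‖v‖)
          = (1 / ‖u‖) * (1 / ‖v‖) ^ 2 + (1 / ‖u‖) ^ 2 * (1 / ‖v‖) := by field_simp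
        _ ≤ (2 / ‖v‖) * (1 / ‖v‖) ^ 2 + (2 / ‖v‖) ^ 2 * (1 / ‖v‖) := by gcongr
        _ = _ := by field_simp; norm_num
    norm_num
    norm_num at this
    calc 5 / 3 * s ^ 2 * ‖ζ - x‖ * _ ≤ 5 / 3 * s ^ 2 * ρ * (6 * (‖v‖ ^ 3)⁻¹) := by gcongr
      _ = 10 * (s * ρ / ‖v‖ ^ 2) * (s / ‖v‖) := by field_simp; ring
      _ ≤ 10 * (s * ρ / ‖v‖ ^ 2) * 1 := by gcongr
      _ = _ := by ring
  rw [e]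
  refine (norm_add_le _ _).trans ((add_le_add t1 t2).trans ?_)
  calc 2 * (s * ρ / ‖v‖ ^ 2) + 10 * (s * ρ / ‖v‖ ^ 2) = 12 * s * ρ / ‖v‖ ^ 2 := by ring
    _ ≤ _ := by
      rw [div_le_div_iff₀ (by positivity) hx2]
      have : 0 ≤ s * ρ := by positivity
      nlinarith

/-! ### The damping product -/

/-- A product of powers of `z / (z - iδ)`. -/
noncomputable def damp (l : List ℝ) (z : ℂ) : ℂ :=
  (l.map fun δ : ℝ => (z / (z - Complex.I * δ)) ^ 10).prod

theorem damp_cons (δ : ℝ) (l : List ℝ) (z : ℂ) :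
    damp (δ :: l) z = (z / (z - Complex.I * δ)) ^ 10 * damp l z := by
  simp [damp]

theorem bddHalfPlane_damp (l : List ℝ) (hl : ∀ δ ∈ l, 0 < δ) : BddHalfPlane (damp l) := by
  induction l with
  | nil => exact BddHalfPlane.const 1
  | cons δ l ih =>
    have hδ : 0 < δ := hl δ (by simp)
    have him : ∀ z : ℂ, z.im < δ / 2 → δ / 2 ≤ ‖z - Complex.I * δ‖ := by
      intro z hz
      refine le_trans ?_ (Complex.abs_im_le_norm _)
      simp only [Complex.sub_im, Complex.mul_im, Complex.ofReal_re, Complex.I_im,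
        Complex.ofReal_im, Complex.I_re, mul_zero, one_mul, zero_add]
      rw [abs_sub_comm]
      refine le_trans ?_ (le_abs_self _)
      linarith
    have h : BddHalfPlane fun z => z / (z - Complex.I * δ) := by
      refine ⟨δ / 2, by positivity, ?_, 3, fun z hz => ?_⟩
      · intro z hz
        have hne : z - Complex.I * δ ≠ 0 :=
          norm_pos_iff.1 (lt_of_lt_of_le (by positivity) (him z hz))
        refine DifferentiableAt.differentiableWithinAt ?_
        fun_prop (disch := exact hne)
      · have h := him z hz
        rw [norm_div, div_le_iff₀ (by linarith)]
        have : ‖z‖ ≤ ‖z - Complex.I * δ‖ + ‖Complex.I * δ‖ := by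
          simpa using norm_add_le (z - Complex.I * δ) (Complex.I * δ)
        rw [norm_mul, Complex.norm_I, one_mul, Complex.norm_real, Real.norm_of_nonneg hδ.le] at this
        linarith
    have := (h.pow 10).mul (ih fun d hd => hl d (by simp [hd]))
    simpa only [← damp_cons] using this

theorem norm_damp_neg_I {Y : ℝ} (hY : 0 < Y) (l : List ℝ) (hl : ∀ δ ∈ l, 0 < δ) :
    Real.exp (-(10 * l.sum / Y)) ≤ ‖damp l (-(Y * Complex.I))‖ := by
  induction l with
  | nil => simp [damp]
  | cons δ l ih =>
    have hδ : 0 < δ := hl δ (by simp)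
    have ih' := ih fun d hd => hl d (by simp [hd])
    have e : (-(Y * Complex.I) / (-(Y * Complex.I) - Complex.I * δ) : ℂ)
        = ((Y / (Y + δ) : ℝ) : ℂ) := by
      have h1 : ((Y : ℂ) + δ) ≠ 0 := by exact_mod_cast (by positivity : Y + δ ≠ 0)
      have h2 : (-(Y * Complex.I) - Complex.I * δ : ℂ) = -(Complex.I * (Y + δ)) := by ring
      rw [h2]
      push_cast
      have := Complex.I_ne_zero
      field_simp
    have h1 : Real.exp (-(δ / Y)) ≤ Y / (Y + δ) := by
      rw [Real.exp_neg, inv_le_comm₀ (Real.exp_pos _) (by positivity), inv_div]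
      have := Real.add_one_le_exp (δ / Y)
      refine le_trans (le_of_eq ?_) this
      field_simp
      ring
    rw [damp_cons, norm_mul, norm_pow, e, Complex.norm_real, Real.norm_of_nonneg (by positivity)]
    calc Real.exp (-(10 * (δ :: l).sum / Y))
        = Real.exp (-(δ / Y)) ^ 10 * Real.exp (-(10 * l.sum / Y)) := by
          rw [← Real.exp_nat_mul, ← Real.exp_add, List.sum_cons]
          congr 1; push_cast; ring
      _ ≤ _ := by gcongr

/-- The exponent 10 yields five copies of `∏ (1 + δ²/x²)` on the line: one is to pay for the
operator `annih`, four for the variation of the outer factor over a small disc. -/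
theorem norm_damp_ofReal {x : ℝ} (hx : x ≠ 0) (l : List ℝ) :
    ‖damp l x‖ * (l.map fun δ => 1 + δ ^ 2 / x ^ 2).prod ^ 5 = 1 := by
  induction l with
  | nil => simp [damp]
  | cons δ l ih =>
    have h1 : ‖(x : ℂ) - Complex.I * δ‖ ^ 2 = x ^ 2 + δ ^ 2 := by
      rw [Complex.sq_norm, Complex.normSq_apply]; simp; ring
    have h2 : ‖(x : ℂ) / (x - Complex.I * δ)‖ ^ 2 = x ^ 2 / (x ^ 2 + δ ^ 2) := by
      rw [norm_div, div_pow, h1, Complex.norm_real, Real.norm_eq_abs, sq_abs]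
    have h3 : ‖(x : ℂ) / (x - Complex.I * δ)‖ ^ 10 * (1 + δ ^ 2 / x ^ 2) ^ 5 = 1 := by
      rw [show 10 = 2 * 5 from rfl, pow_mul, h2, ← mul_pow]
      have : x ^ 2 / (x ^ 2 + δ ^ 2) * (1 + δ ^ 2 / x ^ 2) = 1 := by
        have : 0 < x ^ 2 := by positivity
        field_simp
      rw [this, one_pow]
    rw [damp_cons, norm_mul, norm_pow, List.map_cons, List.prod_cons, mul_pow]
    calc _ = (‖(x : ℂ) / (x - Complex.I * δ)‖ ^ 10 * (1 + δ ^ 2 / x ^ 2) ^ 5)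
        * (‖damp l x‖ * (l.map fun δ => 1 + δ ^ 2 / x ^ 2).prod ^ 5) := by ring
      _ = 1 := by rw [h3, ih, one_mul]

/-- Each quotient `z/(z - iδ)` changes by a relative amount at most `2δρ/x²`; the tenth power gives
the constant 20. -/
theorem norm_damp_le {x ρ : ℝ} {ζ : ℂ} (hρ : ‖ζ - x‖ ≤ ρ) (hρx : ρ ≤ |x| / 20) (hx : x ≠ 0)
    (l : List ℝ) (hl : ∀ δ ∈ l, 0 < δ) :
    ‖damp l ζ‖ ≤ ‖damp l x‖ * Real.exp (20 * l.sum * ρ / x ^ 2) := by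
  have hρ0 : 0 ≤ ρ := (norm_nonneg (ζ - x)).trans hρ
  have hx2 : 0 < x ^ 2 := by positivity
  have hxa : 0 < |x| := abs_pos.2 hx
  induction l with
  | nil => simp [damp]
  | cons δ l ih =>
    have hδ : 0 < δ := hl δ (by simp)
    have ih' := ih fun d hd => hl d (by simp [hd])
    have hxd : |x| ≤ ‖(x : ℂ) - Complex.I * δ‖ := by
      have := Complex.abs_re_le_norm ((x : ℂ) - Complex.I * δ)
      simpa using this
    have hζd : |x| / 2 ≤ ‖ζ - Complex.I * δ‖ := by
      have h1 : ‖(x : ℂ) - Complex.I * δ‖ - ‖ζ - Complex.I * δ‖ ≤ ‖ζ - x‖ := by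
        refine (norm_sub_norm_le _ _).trans (le_of_eq ?_)
        rw [norm_sub_rev ζ]; congr 1; ring
      linarith
    have n1 : (x : ℂ) - Complex.I * δ ≠ 0 := norm_pos_iff.1 (hxa.trans_le hxd)
    have n2 : ζ - Complex.I * δ ≠ 0 := norm_pos_iff.1 (by linarith)
    have n3 : (x : ℂ) ≠ 0 := by exact_mod_cast hx
    have e : ζ / (ζ - Complex.I * δ) = x / (x - Complex.I * δ)
        * (1 + -(Complex.I * δ * (ζ - x)) / (x * (ζ - Complex.I * δ))) := by
      field_simp
      ring
    have h1 : ‖(1 + -(Complex.I * δ * (ζ - x)) / (x * (ζ - Complex.I * δ)) : ℂ)‖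
        ≤ Real.exp (2 * δ * ρ / x ^ 2) := by
      refine (norm_add_le _ _).trans ?_
      rw [norm_one, norm_div, norm_neg, norm_mul, norm_mul, norm_mul, Complex.norm_I, one_mul,
        Complex.norm_real, Complex.norm_real, Real.norm_of_nonneg hδ.le, Real.norm_eq_abs]
      refine le_trans ?_ (Real.add_one_le_exp _)
      rw [add_comm]
      gcongr ?_ + 1
      calc δ * ‖ζ - x‖ / (|x| * ‖ζ - Complex.I * δ‖) ≤ δ * ρ / (|x| * (|x| / 2)) := by gcongr
        _ = 2 * δ * ρ / |x| ^ 2 := by field_simp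
        _ = _ := by rw [sq_abs]
    have h2 : ‖ζ / (ζ - Complex.I * δ)‖
        ≤ ‖(x / (x - Complex.I * δ) : ℂ)‖ * Real.exp (2 * δ * ρ / x ^ 2) := by
      rw [e, norm_mul]; gcongr
    rw [damp_cons, damp_cons, norm_mul, norm_mul, norm_pow, norm_pow]
    calc ‖ζ / (ζ - Complex.I * δ)‖ ^ 10 * ‖damp l ζ‖
        ≤ (‖(x / (x - Complex.I * δ) : ℂ)‖ * Real.exp (2 * δ * ρ / x ^ 2)) ^ 10
          * (‖damp l x‖ * Real.exp (20 * l.sum * ρ / x ^ 2)) := by gcongr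
      _ = ‖(x / (x - Complex.I * δ) : ℂ)‖ ^ 10 * ‖damp l x‖
          * (Real.exp (2 * δ * ρ / x ^ 2) ^ 10 * Real.exp (20 * l.sum * ρ / x ^ 2)) := by ring
      _ = _ := by
        rw [← Real.exp_nat_mul, ← Real.exp_add, List.sum_cons]
        congr 2; push_cast; ring

/-! ### The test functions: pairing with exponentials and size -/

theorem BddHalfPlane.stripDecay {h : ℂ → ℂ} (hh : BddHalfPlane h) {Y : ℝ} (hY : 0 < Y) :
    ∃ η > 0, StripDecay η fun z => h z / (z ^ 2 + (Y : ℂ) ^ 2) := by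
  obtain ⟨η, hη, hd, K, hK⟩ := hh
  have hK0 : 0 ≤ K := (norm_nonneg _).trans (hK 0 (by simpa using hη))
  set m := min 1 (Y / 2) with hm
  have hm0 : 0 < m := by positivity
  have hlow : ∀ z : ℂ, |z.im| < min η (Y / 2) →
      m ^ 2 * (1 + z.re ^ 2) ≤ ‖z ^ 2 + (Y : ℂ) ^ 2‖ := by
    intro z hz
    have hz2 : |z.im| ≤ Y / 2 := (hz.trans_le (min_le_right _ _)).le
    have hz3 := abs_le.1 hz2
    have e : z ^ 2 + (Y : ℂ) ^ 2 = (z - Y * Complex.I) * (z + Y * Complex.I) := by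
      ring_nf; rw [Complex.I_sq]; ring
    have hm1 : m ≤ 1 := min_le_left _ _
    have hm2 : m ≤ Y / 2 := min_le_right _ _
    have hmsq : m ^ 2 ≤ 1 := by nlinarith
    have key : ∀ t : ℝ, Y / 2 ≤ |t| → m ^ 2 * (1 + z.re ^ 2) ≤ z.re ^ 2 + t ^ 2 := by
      intro t ht
      have h1 : m ^ 2 ≤ t ^ 2 := by
        rw [← sq_abs t]; exact pow_le_pow_left₀ hm0.le (hm2.trans ht) 2
      nlinarith [sq_nonneg z.re]
    have k1 := key (z.im - Y) (by rw [abs_of_nonpos (by linarith)]; linarith)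
    have k2 := key (z.im + Y) (by rw [abs_of_nonneg (by linarith)]; linarith)
    have n1 : ‖z - Y * Complex.I‖ ^ 2 = z.re ^ 2 + (z.im - Y) ^ 2 := by
      rw [Complex.sq_norm, Complex.normSq_apply]; simp; ring
    have n2 : ‖z + Y * Complex.I‖ ^ 2 = z.re ^ 2 + (z.im + Y) ^ 2 := by
      rw [Complex.sq_norm, Complex.normSq_apply]; simp; ring
    rw [e, norm_mul, ← sq_le_sq₀ (by positivity) (by positivity), mul_pow ‖_‖, n1, n2, sq (_ * _)]
    exact mul_le_mul k1 k2 (by positivity) (by positivity)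
  refine ⟨min η (Y / 2), by positivity, ?_, K / m ^ 2, by positivity, fun z hz => ?_⟩
  · refine (hd.mono fun z (hz : |z.im| < _) => ?_).div (by fun_prop) ?_
    · exact (le_abs_self _).trans_lt (hz.trans_le (min_le_left _ _))
    · intro z hz
      exact norm_pos_iff.1 (lt_of_lt_of_le (by positivity) (hlow z hz))
  · rw [norm_div, div_div]
    have h1 := hlow z hz
    gcongr
    exact hK z ((le_abs_self _).trans_lt (hz.trans_le (min_le_left _ _)))

theorem bddHalfPlane_exp {μ : ℝ} (hμ : μ ≤ 0) :
    BddHalfPlane fun z => Complex.exp (2 * Real.pi * Complex.I * μ * z) := by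
  refine ⟨1, one_pos, by fun_prop, Real.exp (2 * Real.pi * -μ), fun z hz => ?_⟩
  rw [Complex.norm_exp]
  have : (2 * Real.pi * Complex.I * μ * z).re = 2 * Real.pi * -μ * z.im := by
    simp
  rw [this]
  refine Real.exp_le_exp.2 ?_
  have : 0 ≤ 2 * Real.pi * -μ := mul_nonneg (by positivity) (by linarith)
  nlinarith

theorem integral_expo_mul_div {h : ℂ → ℂ} (hh : BddHalfPlane h) {Y μ : ℝ} (hY : 0 < Y)
    (hμ : μ ≤ 0) : ∫ x : ℝ, expo μ x * (h x / ((x : ℂ) ^ 2 + (Y : ℂ) ^ 2))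
      = Real.pi / Y * (Real.exp (2 * Real.pi * μ * Y) * h (-(Y * Complex.I))) := by
  obtain ⟨η, hη, hd, K, hK⟩ := (bddHalfPlane_exp hμ).mul hh
  have := integral_lowerHalfPlane_poisson (η := min η Y) (by positivity) (min_le_right _ _)
    (hd.mono fun z (hz : z.im < min η Y) => show z.im < η from hz.trans_le (min_le_left _ _))
    (fun z hz => hK z (hz.trans_le (min_le_left _ _)))
  have e : (2 * Real.pi * Complex.I * μ * -(Y * Complex.I) : ℂ)
      = ((2 * Real.pi * μ * Y : ℝ) : ℂ) := by
    push_cast; ring_nf; rw [Complex.I_sq]; ring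
  rw [e, ← Complex.ofReal_exp] at this
  rw [← this]
  congr 1; ext x; rw [expo]; ring

/-- The outer factor of the test functions: `bump`s make it large on the right of the origin,
`damp` compensates the loss caused by `annih l`. -/
noncomputable def outerFactor (N : ℕ) (c s : ℕ → ℝ) (A : ℝ) (l : List ℝ) (z : ℂ) : ℂ :=
  Complex.exp (∑ n ∈ Finset.range N, c n * bump (s n) z)
    * damp (l.map fun γ => √(A * (1 / (2 * Real.pi * γ)))) z

theorem bddHalfPlane_outerFactor (N : ℕ) {c s : ℕ → ℝ} (hs : ∀ n, 0 < s n) {A : ℝ} (hA : 0 < A)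
    {l : List ℝ} (hl : ∀ γ ∈ l, 0 < γ) : BddHalfPlane (outerFactor N c s A l) := by
  refine BddHalfPlane.mul (BddHalfPlane.cexp (BddHalfPlane.sum _ fun n _ =>
    (BddHalfPlane.const _).mul (bddHalfPlane_bump (hs n)))) (bddHalfPlane_damp _ ?_)
  simp only [List.mem_map]
  rintro _ ⟨γ, hγ, rfl⟩
  have := hl γ hγ
  positivity

theorem norm_outerFactor_neg_I (N : ℕ) {c s : ℕ → ℝ} (hc : ∀ n, 0 ≤ c n) (hs : ∀ n, 0 < s n)
    {A Y σ : ℝ} (hA : 0 < A) {l : List ℝ} (hl : ∀ γ ∈ l, 0 < γ) (hY0 : 0 < Y)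
    (hY : ∀ n, s n ≤ Y) (hσ : (l.map fun γ => √(1 / (2 * Real.pi * γ))).sum ≤ σ) :
    Real.exp ((∑ n ∈ Finset.range N, c n * s n) / (4 * Y) - 10 * (√A * σ) / Y)
      ≤ ‖outerFactor N c s A l (-(Y * Complex.I))‖ := by
  rw [outerFactor, norm_mul, sub_eq_add_neg, Real.exp_add]
  refine mul_le_mul ?_ ?_ (Real.exp_pos _).le (norm_nonneg _)
  · rw [Complex.norm_exp, Complex.re_sum, Finset.sum_div]
    refine Real.exp_le_exp.2 (Finset.sum_le_sum fun n _ => ?_)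
    rw [Complex.re_ofReal_mul, mul_div_assoc]
    exact mul_le_mul_of_nonneg_left (bump_re_neg_I (hs n) (hY n)) (hc n)
  · refine le_trans (Real.exp_le_exp.2 ?_) (norm_damp_neg_I hY0 _ ?_)
    · have : (l.map fun γ => √(A * (1 / (2 * Real.pi * γ)))).sum ≤ √A * σ := by
        simp_rw [Real.sqrt_mul hA.le]
        rw [List.sum_map_mul_left]
        gcongr
      gcongr
    · simp only [List.mem_map]
      rintro _ ⟨γ, hγ, rfl⟩
      have := hl γ hγ
      positivity

/-- Since `R c/(1+cR) = 1 - 1/(1+cR) ≤ log(1+cR)`. This converts exponential variation over the disc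
into powers of the product that `damp` compensates. -/
theorem exp_sum_le_prod {R : ℝ} (hR : 0 ≤ R) (l : List ℝ) (hl : ∀ c ∈ l, 0 < c) :
    Real.exp (R * (l.map fun c => c / (1 + c * R)).sum) ≤ (l.map fun c => 1 + c * R).prod := by
  induction l with
  | nil => simp
  | cons c l ih =>
    have hc : 0 < c := hl c (by simp)
    have ih' := ih fun d hd => hl d (by simp [hd])
    have h1 : Real.exp (R * (c / (1 + c * R))) ≤ 1 + c * R := by
      have hp : 0 < 1 + c * R := by positivity
      rw [← Real.le_log_iff_exp_le hp]
      refine le_trans (le_of_eq ?_) (Real.one_sub_inv_le_log_of_pos hp)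
      field_simp
      ring
    simp only [List.map_cons, List.sum_cons, List.prod_cons]
    rw [mul_add, Real.exp_add]
    gcongr

/-- AM–GM in the form `2√(cR) ≤ 1 + cR`. With `R = A/x²` and `c = 1/(2πγ)` it bounds the disc radius
by `σ|x|/√A`, a small fraction of `|x|`. -/
theorem sum_div_le_sum_sqrt {R : ℝ} (hR : 0 < R) (l : List ℝ) (hl : ∀ c ∈ l, 0 < c) :
    2 * (l.map fun c => c / (1 + c * R)).sum ≤ (l.map fun c => √c).sum / √R := by
  induction l with
  | nil => simp
  | cons c l ih =>
    have hc : 0 < c := hl c (by simp)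
    have ih' := ih fun d hd => hl d (by simp [hd])
    simp only [List.map_cons, List.sum_cons]
    have h1 : 2 * (c / (1 + c * R)) ≤ √c / √R := by
      have hs := Real.sqrt_pos.2 hc
      have hr := Real.sqrt_pos.2 hR
      rw [← mul_div_assoc, div_le_div_iff₀ (by positivity) hr]
      conv_lhs => rw [← Real.sq_sqrt hc.le]
      have e : 1 + c * R = 1 + (√c * √R) ^ 2 := by
        rw [mul_pow, Real.sq_sqrt hc.le, Real.sq_sqrt hR.le]
      rw [e]
      nlinarith [mul_nonneg hs.le (sq_nonneg (√c * √R - 1))]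
    rw [mul_add, add_div]
    exact add_le_add h1 ih'

/-- The bump poles `s(2+i)` violate `3|Im ζ| ≤ |Re ζ|`, and the `damp` poles lie on the imaginary
axis. -/
theorem analyticAt_outerFactor (N : ℕ) (c : ℕ → ℝ) {s : ℕ → ℝ} (hs : ∀ n, 0 < s n) (A : ℝ)
    (l : List ℝ) {ζ : ℂ} (h0 : ζ.re ≠ 0) (hζ : 3 * |ζ.im| ≤ |ζ.re|) :
    AnalyticAt ℂ (outerFactor N c s A l) ζ := by
  refine AnalyticAt.mul (AnalyticAt.cexp (Finset.analyticAt_fun_sum _ fun n _ =>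
    analyticAt_const.mul ?_)) ?_
  · have hne : ζ - s n * (2 + Complex.I) ≠ 0 := by
      intro h
      have h1 := congrArg Complex.re h
      have h2 := congrArg Complex.im h
      simp only [Complex.sub_re, Complex.mul_re, Complex.ofReal_re, Complex.add_re, Complex.re_ofNat,
        Complex.I_re, add_zero, Complex.ofReal_im, zero_mul, sub_zero, Complex.zero_re,
        Complex.sub_im, Complex.mul_im, Complex.add_im, Complex.im_ofNat, Complex.I_im, zero_add,
        mul_one, Complex.zero_im] at h1 h2
      have hsn := hs n
      rw [sub_eq_zero.1 h1, sub_eq_zero.1 h2, abs_of_pos hsn, abs_of_pos (by positivity)] at hζ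
      linarith
    unfold bump
    refine AnalyticAt.sub ?_ ?_
    · exact analyticAt_const.div (by fun_prop) hne
    · exact analyticAt_const.div (by fun_prop) (pow_ne_zero 2 hne)
  · generalize l.map _ = ds
    induction ds with
    | nil => exact analyticAt_const
    | cons δ ds ih =>
      have hne : ζ - Complex.I * δ ≠ 0 := by
        intro h
        have h1 := congrArg Complex.re h
        simp only [Complex.sub_re, Complex.mul_re, Complex.I_re, zero_mul, Complex.I_im,
          Complex.ofReal_im, mul_zero, sub_zero, Complex.zero_re] at h1
        exact h0 h1
      have e : damp (δ :: ds) = fun z => (z / (z - Complex.I * δ)) ^ 10 * damp ds z :=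
        funext fun z => damp_cons δ ds z
      rw [e]
      have h1 : AnalyticAt ℂ (fun z : ℂ => z / (z - Complex.I * δ)) ζ :=
        AnalyticAt.fun_div analyticAt_id (by fun_prop) hne
      exact (h1.fun_pow 10).fun_mul ih

/-- Let `P = ∏ (1 + cR)` with `R = A/x²`. On the disc of radius `2T` about `x` the bump exponential
and `damp` each grow by at most `exp(2RT)`, and `exp(4RT) ≤ P⁴`. The operator costs one more `P`,
and `damp` equals `P⁻⁵` in modulus at `x`. The constant 4 is a factor 2 from the kernel `1/(z²+Y²)`
times the 2 of `norm_annih_le`. -/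
theorem norm_annih_outerFactor_le (N : ℕ) {c s : ℕ → ℝ} (hc : ∀ n, 0 ≤ c n) (hs : ∀ n, 0 < s n)
    {A Y σ : ℝ} (hA : 0 < A) {l : List ℝ} (hl : ∀ γ ∈ l, 0 < γ) (hY : 0 < Y)
    (hσ : (l.map fun γ => √(1 / (2 * Real.pi * γ))).sum ≤ σ)
    (hAC : 60 * ∑ n ∈ Finset.range N, c n * s n ≤ A) (hAσ : 20 * σ ≤ √A) {x : ℝ} (hx : x ≠ 0) :
    ‖annih l (fun z => outerFactor N c s A l z / (z ^ 2 + (Y : ℂ) ^ 2)) x‖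
      ≤ 4 * (Real.exp (∑ n ∈ Finset.range N, c n * (bump (s n) x).re) / (x ^ 2 + Y ^ 2)) := by
  have hx2 : 0 < x ^ 2 := by positivity
  have hxa : 0 < |x| := abs_pos.2 hx
  set k := l.map fun γ => 1 / (2 * Real.pi * γ) with hk
  have hk0 : ∀ c ∈ k, 0 < c := by
    simp only [hk, List.mem_map]
    rintro _ ⟨γ, hγ, rfl⟩
    have := hl γ hγ
    positivity
  -- With this `R` and `δ² = Ac`, the damping factor `1 + δ²/x²` is exactly the operator cost `1 +
  -- cR`.
  set R := A / x ^ 2 with hR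
  have hR0 : 0 < R := by positivity
  set G := ∑ n ∈ Finset.range N, c n * (bump (s n) x).re with hG
  set P := (k.map fun c => 1 + c * R).prod with hP
  set T := (k.map fun c => c / (1 + c * R)).sum with hT
  have hT0 : 0 ≤ T := List.sum_nonneg (by
    simp only [List.mem_map]; rintro _ ⟨c, hc, rfl⟩; have := hk0 c hc; positivity)
  have hσ' : (k.map fun c => √c).sum ≤ σ := by rw [hk, List.map_map]; exact hσ
  set ds := l.map fun γ => √(A * (1 / (2 * Real.pi * γ))) with hds
  have hds0 : ∀ δ ∈ ds, 0 < δ := by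
    simp only [hds, List.mem_map]
    rintro _ ⟨γ, hγ, rfl⟩
    have := hl γ hγ
    positivity
  have hdsum : 20 * ds.sum ≤ A := by
    have e : ds.sum = √A * (k.map fun c => √c).sum := by
      rw [hds, hk, List.map_map]
      simp_rw [Real.sqrt_mul hA.le]
      rw [List.sum_map_mul_left]; rfl
    have h1 : √A * √A = A := Real.mul_self_sqrt hA.le
    have h2 := Real.sqrt_nonneg A
    rw [e]
    nlinarith
  have hdamp : ‖damp ds x‖ * P ^ 5 = 1 := by
    rw [← norm_damp_ofReal hx ds, hP, hk, hds, List.map_map, List.map_map]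
    congr 3
    refine List.map_congr_left fun γ hγ => ?_
    have := hl γ hγ
    simp only [Function.comp]
    rw [Real.sq_sqrt (by positivity), hR]
    ring
  have hρx : 2 * T ≤ |x| / 20 := by
    have h1 := sum_div_le_sum_sqrt hR0 k hk0
    have h2 : √R = √A / |x| := by rw [hR, Real.sqrt_div hA.le, Real.sqrt_sq_eq_abs]
    have h3 : 0 < √A := Real.sqrt_pos.2 hA
    refine h1.trans ?_
    rw [h2, div_div_eq_mul_div, div_le_div_iff₀ h3 (by norm_num)]
    nlinarith
  have hP1 : Real.exp (R * T) ≤ P := exp_sum_le_prod hR0.le k hk0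
  have hP0 : 0 < P := (Real.exp_pos _).trans_le hP1
  have hPexp : Real.exp (4 * (R * T)) ≤ P ^ 4 := by
    have := pow_le_pow_left₀ (Real.exp_pos _).le hP1 4
    rw [← Real.exp_nat_mul] at this
    exact_mod_cast this
  have hbase : ∀ ζ ∈ Metric.closedBall (x : ℂ) (2 * T),
      ‖outerFactor N c s A l ζ‖ ≤ Real.exp G * ‖damp ds x‖ * Real.exp (4 * (R * T)) := by
    intro ζ hζ
    have hζ' : ‖ζ - x‖ ≤ 2 * T := by simpa [dist_eq_norm] using hζ
    have h1 := norm_damp_le hζ' hρx hx ds hds0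
    have h2 : ‖Complex.exp (∑ n ∈ Finset.range N, c n * bump (s n) ζ)‖
        ≤ Real.exp (G + 60 * (∑ n ∈ Finset.range N, c n * s n) * (2 * T) / x ^ 2) := by
      rw [Complex.norm_exp]
      refine Real.exp_le_exp.2 ?_
      rw [Complex.re_sum, hG, Finset.mul_sum, Finset.sum_mul, Finset.sum_div,
        ← Finset.sum_add_distrib]
      refine Finset.sum_le_sum fun n _ => ?_
      have h3 := bump_sub_le (hs n) hζ' hρx hx
      have h4 : (bump (s n) ζ).re - (bump (s n) x).re ≤ ‖bump (s n) ζ - bump (s n) x‖ := by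
        rw [← Complex.sub_re]; exact Complex.re_le_norm _
      rw [Complex.re_ofReal_mul]
      calc c n * (bump (s n) ζ).re
          ≤ c n * ((bump (s n) x).re + 60 * s n * (2 * T) / x ^ 2) :=
            mul_le_mul_of_nonneg_left (by linarith) (hc n)
        _ = _ := by ring
    rw [outerFactor, norm_mul]
    refine (mul_le_mul h2 h1 (norm_nonneg _) (Real.exp_pos _).le).trans ?_
    calc _ = Real.exp G * ‖damp ds x‖ * Real.exp ((60 * (∑ n ∈ Finset.range N, c n * s n)
          + 20 * ds.sum) * (2 * T) / x ^ 2) := by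
          have : (60 * (∑ n ∈ Finset.range N, c n * s n) + 20 * ds.sum) * (2 * T) / x ^ 2
            = 60 * (∑ n ∈ Finset.range N, c n * s n) * (2 * T) / x ^ 2
              + 20 * ds.sum * (2 * T) / x ^ 2 := by ring
          rw [this, Real.exp_add, Real.exp_add]
          ring
      _ ≤ _ := by
        have : (60 * (∑ n ∈ Finset.range N, c n * s n) + 20 * ds.sum) * (2 * T) / x ^ 2
            ≤ 4 * (R * T) := by
          calc _ ≤ (A + A) * (2 * T) / x ^ 2 := by gcongr
            _ = _ := by rw [hR]; ring
        gcongr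
  have hker : ∀ ζ ∈ Metric.closedBall (x : ℂ) (2 * T),
      x ^ 2 + Y ^ 2 ≤ 2 * ‖ζ ^ 2 + (Y : ℂ) ^ 2‖ := by
    intro ζ hζ
    have hζ' : ‖ζ - x‖ ≤ 2 * T := by simpa [dist_eq_norm] using hζ
    have e : ζ ^ 2 + (Y : ℂ) ^ 2 = (ζ - Y * Complex.I) * (ζ + Y * Complex.I) := by
      ring_nf; rw [Complex.I_sq]; ring
    have n1 : ‖(x : ℂ) - Y * Complex.I‖ ^ 2 = x ^ 2 + Y ^ 2 := by
      rw [Complex.sq_norm, Complex.normSq_apply]; simp; ring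
    have n2 : ‖(x : ℂ) + Y * Complex.I‖ ^ 2 = x ^ 2 + Y ^ 2 := by
      rw [Complex.sq_norm, Complex.normSq_apply]; simp; ring
    set B := √(x ^ 2 + Y ^ 2) with hB
    have hB2 : B ^ 2 = x ^ 2 + Y ^ 2 := Real.sq_sqrt (by positivity)
    have m1 : ‖(x : ℂ) - Y * Complex.I‖ = B := by rw [hB, ← n1, Real.sqrt_sq (norm_nonneg _)]
    have m2 : ‖(x : ℂ) + Y * Complex.I‖ = B := by rw [hB, ← n2, Real.sqrt_sq (norm_nonneg _)]
    have hBx : |x| ≤ B := by rw [hB]; exact Real.abs_le_sqrt (by nlinarith [sq_nonneg Y])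
    have g1 : B - ‖ζ - Y * Complex.I‖ ≤ 2 * T := by
      rw [← m1]
      refine (norm_sub_norm_le _ _).trans (le_trans (le_of_eq ?_) hζ')
      rw [norm_sub_rev]; congr 1; ring
    have g2 : B - ‖ζ + Y * Complex.I‖ ≤ 2 * T := by
      rw [← m2]
      refine (norm_sub_norm_le _ _).trans (le_trans (le_of_eq ?_) hζ')
      rw [norm_sub_rev]; congr 1; ring
    rw [e, norm_mul, ← hB2]
    have hB0 : 0 < B := hxa.trans_le hBx
    have k1 : 19 / 20 * B ≤ ‖ζ - Y * Complex.I‖ := by linarith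
    have k2 : 19 / 20 * B ≤ ‖ζ + Y * Complex.I‖ := by linarith
    have := mul_le_mul k1 k2 (by positivity) (norm_nonneg _)
    nlinarith
  have hS0 : 0 < x ^ 2 + Y ^ 2 := by positivity
  have hM : ∀ ζ ∈ Metric.closedBall (x : ℂ) (2 * T),
      ‖outerFactor N c s A l ζ / (ζ ^ 2 + (Y : ℂ) ^ 2)‖
        ≤ 2 * (Real.exp G * ‖damp ds x‖ * Real.exp (4 * (R * T))) / (x ^ 2 + Y ^ 2) := by
    intro ζ hζ
    have h1 := hbase ζ hζ
    have h2 := hker ζ hζ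
    rw [norm_div, div_le_div_iff₀ (by linarith) hS0]
    calc _ ≤ (Real.exp G * ‖damp ds x‖ * Real.exp (4 * (R * T)))
          * (2 * ‖ζ ^ 2 + (Y : ℂ) ^ 2‖) := by gcongr
      _ = _ := by ring
  have hfin : Real.exp G * ‖damp ds x‖ * Real.exp (4 * (R * T)) * P ≤ Real.exp G := by
    calc _ ≤ Real.exp G * ‖damp ds x‖ * P ^ 4 * P := by gcongr
      _ = Real.exp G * (‖damp ds x‖ * P ^ 5) := by ring
      _ = _ := by rw [hdamp, mul_one]
  -- For the empty list `T = 0` and the disc degenerates to a point, so `norm_annih_le` does not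
  -- apply; the bound at the centre suffices.
  rcases eq_or_ne l [] with hnil | hne
  · subst hnil
    have h0 := hM x (Metric.mem_closedBall_self (by linarith))
    have hPone : P = 1 := by simp [hP, hk]
    rw [hPone, mul_one] at hfin
    refine h0.trans ?_
    rw [mul_div_assoc]
    have : 0 ≤ Real.exp G / (x ^ 2 + Y ^ 2) := by positivity
    have : Real.exp G * ‖damp ds x‖ * Real.exp (4 * (R * T)) / (x ^ 2 + Y ^ 2)
      ≤ Real.exp G / (x ^ 2 + Y ^ 2) := by gcongr
    linarith
  · have hbound := norm_annih_le (ρ := 2 * T) (R := R) hR0.le l hne hl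
      (by rw [hT, hk, List.map_map]; rfl) (f := fun z => outerFactor N c s A l z / (z ^ 2 + (Y : ℂ) ^ 2))
      (x := x) ?_ hM
    · refine hbound.trans ?_
      have e : (l.map fun γ => 1 + 1 / (2 * Real.pi * γ) * R).prod = P := by
        rw [hP, hk, List.map_map]; rfl
      rw [e]
      calc _ = 4 * (Real.exp G * ‖damp ds x‖ * Real.exp (4 * (R * T)) * P / (x ^ 2 + Y ^ 2)) := by
            ring
        _ ≤ _ := by gcongr
    · intro ζ hζ
      have hζ' : ‖ζ - x‖ ≤ 2 * T := by simpa [dist_eq_norm] using hζ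
      have h1 := (Complex.abs_re_le_norm (ζ - x)).trans hζ'
      have h2 := (Complex.abs_im_le_norm (ζ - x)).trans hζ'
      simp only [Complex.sub_re, Complex.ofReal_re, Complex.sub_im, Complex.ofReal_im,
        sub_zero] at h1 h2
      have h3 : |x| - |ζ.re| ≤ |ζ.re - x| := by rw [abs_sub_comm]; exact abs_sub_abs_le_abs_sub _ _
      refine (analyticAt_outerFactor N c hs A l (abs_pos.1 (by linarith)) (by linarith)).div
        (by fun_prop) (norm_pos_iff.1 ?_)
      have := hker ζ hζ
      linarith

/-! ### Convergence of the series in a weighted `L²` on the whole line -/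

/-- The finite measure `dx / (1 + x²)` on the line. -/
noncomputable def cauchyWeight : Measure ℝ :=
  volume.withDensity fun x => ENNReal.ofReal (1 / (1 + x ^ 2))

instance isFiniteMeasure_cauchyWeight : IsFiniteMeasure cauchyWeight :=
  isFiniteMeasure_withDensity_ofReal (by simpa using integrable_inv_one_add_sq.2)

theorem measurable_cauchyDensity : Measurable fun x : ℝ => ENNReal.ofReal (1 / (1 + x ^ 2)) := by
  fun_prop

theorem integral_cauchyWeight (g : ℝ → ℂ) :
    ∫ x, g x ∂cauchyWeight = ∫ x : ℝ, g x / ((x : ℂ) ^ 2 + ((1 : ℝ) : ℂ) ^ 2) := by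
  rw [cauchyWeight, integral_withDensity_eq_integral_toReal_smul measurable_cauchyDensity
    (Eventually.of_forall fun _ => ENNReal.ofReal_lt_top)]
  congr 1; ext x
  rw [ENNReal.toReal_ofReal (by positivity), Complex.real_smul]
  push_cast
  ring

theorem volume_restrict_le_cauchyWeight (R : ℝ) :
    volume.restrict (Icc (-R) R) ≤ ENNReal.ofReal (1 + R ^ 2) • cauchyWeight := by
  rw [cauchyWeight, ← withDensity_smul _ measurable_cauchyDensity, ← withDensity_indicator_one
    measurableSet_Icc]
  refine withDensity_mono (Eventually.of_forall fun x => ?_)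
  by_cases hx : x ∈ Icc (-R) R
  · rw [indicator_of_mem hx, Pi.smul_apply, smul_eq_mul, ← ENNReal.ofReal_mul (by positivity),
      Pi.one_apply, ← ENNReal.ofReal_one]
    refine ENNReal.ofReal_le_ofReal ?_
    rw [mul_one_div, le_div_iff₀ (by positivity), one_mul]
    have : x ^ 2 ≤ R ^ 2 := sq_le_sq' hx.1 hx.2
    linarith
  · rw [indicator_of_notMem hx]; exact zero_le

theorem eLpNorm_Icc_le_cauchyWeight (R : ℝ) (f : ℝ → ℂ) :
    eLpNorm f 2 (volume.restrict (Icc (-R) R))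
      ≤ ENNReal.ofReal (1 + R ^ 2) ^ (1 / (2 : ℝ≥0∞)).toReal * eLpNorm f 2 cauchyWeight := by
  refine (eLpNorm_mono_measure f (volume_restrict_le_cauchyWeight R)).trans (le_of_eq ?_)
  rw [eLpNorm_smul_measure_of_ne_top (by norm_num), smul_eq_mul]

theorem expo_neg (α t : ℝ) : expo α (-t) = expo (-α) t := by
  rw [expo, expo]; congr 1; push_cast; ring

theorem expo_mul (α β t : ℝ) : expo α t * expo β t = expo (α + β) t := by
  rw [expo, expo, expo, ← Complex.exp_add]; congr 1; push_cast; ring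

theorem conj_expo (α t : ℝ) : (starRingEnd ℂ) (expo α t) = expo (-α) t := by
  rw [expo, expo, ← Complex.exp_conj]
  congr 1
  simp only [map_mul, Complex.conj_ofReal, Complex.conj_I, map_ofNat]
  push_cast; ring

/-- The Poisson formula with constant `h` and `Y = 1`; positive frequencies follow by reflection.
The resulting exponential decay of the Gram matrix is what allows Schur's test. -/
theorem integral_expo_cauchyWeight (ξ : ℝ) :
    ∫ x, expo ξ x ∂cauchyWeight = Real.pi * Real.exp (-(2 * Real.pi) * |ξ|) := by
  have key : ∀ μ ≤ 0, ∫ x : ℝ, expo μ x / ((x : ℂ) ^ 2 + ((1 : ℝ) : ℂ) ^ 2)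
      = Real.pi * Real.exp (2 * Real.pi * μ) := by
    intro μ hμ
    have := integral_expo_mul_div (BddHalfPlane.const 1) one_pos hμ
    simp only [mul_one_div] at this
    rw [this]; simp
  rw [integral_cauchyWeight]
  rcases le_total ξ 0 with h | h
  · rw [key ξ h, abs_of_nonpos h]; congr 3; ring_nf
  · rw [← integral_neg_eq_self]
    simp only [expo_neg, Complex.ofReal_neg, neg_sq]
    rw [key (-ξ) (by linarith), abs_of_nonneg h]; congr 3; ring_nf

theorem memLp_expo (α : ℝ) : MemLp (expo α) 2 cauchyWeight :=
  MemLp.of_bound (continuous_expo α).aestronglyMeasurable 1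
    (Eventually.of_forall fun t => (norm_expo α t).le)

theorem inner_expo (α β : ℝ) :
    inner ℂ ((memLp_expo α).toLp) ((memLp_expo β).toLp)
      = ((Real.pi * Real.exp (-(2 * Real.pi) * |α - β|) : ℝ) : ℂ) := by
  rw [L2.inner_def]
  have : ∫ t, inner ℂ ((memLp_expo α).toLp (expo α) t)
      ((memLp_expo β).toLp (expo β) t) ∂cauchyWeight
      = ∫ t, expo (β - α) t ∂cauchyWeight := by
    refine integral_congr_ae ?_
    filter_upwards [(memLp_expo α).coeFn_toLp, (memLp_expo β).coeFn_toLp] with t h1 h2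
    rw [h1, h2, RCLike.inner_apply, conj_expo, expo_mul]
    ring_nf
  rw [this, integral_expo_cauchyWeight, abs_sub_comm]
  push_cast; rfl

/-- A Bessel inequality by Schur's test. -/
theorem norm_sum_smul_sq_le {ι E : Type*} [NormedAddCommGroup E] [InnerProductSpace ℂ E]
    (v : ι → E) (m : ι → ι → ℝ) (hm : ∀ i j, ‖(inner ℂ (v i) (v j) : ℂ)‖ ≤ m i j)
    (hsymm : ∀ i j, m i j = m j i) {K : ℝ} (p : Finset ι) (hK : ∀ i, ∑ j ∈ p, m i j ≤ K)
    (a : ι → ℂ) : ‖∑ i ∈ p, a i • v i‖ ^ 2 ≤ K * ∑ i ∈ p, ‖a i‖ ^ 2 := by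
  have h1 : ‖∑ i ∈ p, a i • v i‖ ^ 2 = ‖(inner ℂ (∑ i ∈ p, a i • v i) (∑ i ∈ p, a i • v i) : ℂ)‖ := by
    rw [inner_self_eq_norm_sq_to_K]; simp
  have h2 : ‖(inner ℂ (∑ i ∈ p, a i • v i) (∑ i ∈ p, a i • v i) : ℂ)‖
      ≤ ∑ i ∈ p, ∑ j ∈ p, ‖a i‖ * ‖a j‖ * m i j := by
    rw [sum_inner]
    refine norm_sum_le_of_le _ fun i _ => ?_
    rw [inner_sum]
    refine norm_sum_le_of_le _ fun j _ => ?_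
    rw [inner_smul_left, inner_smul_right, norm_mul, norm_mul, RCLike.norm_conj, ← mul_assoc]
    exact mul_le_mul_of_nonneg_left (hm i j) (by positivity)
  have h3 : ∑ i ∈ p, ∑ j ∈ p, ‖a i‖ * ‖a j‖ * m i j
      ≤ ∑ i ∈ p, ∑ j ∈ p, (‖a i‖ ^ 2 * m i j / 2 + ‖a j‖ ^ 2 * m j i / 2) := by
    refine Finset.sum_le_sum fun i _ => Finset.sum_le_sum fun j _ => ?_
    have h0 : 0 ≤ m i j := (norm_nonneg _).trans (hm i j)
    rw [hsymm j i]
    nlinarith [mul_nonneg h0 (sq_nonneg (‖a i‖ - ‖a j‖))]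
  have h4 : ∑ i ∈ p, ∑ j ∈ p, (‖a i‖ ^ 2 * m i j / 2 + ‖a j‖ ^ 2 * m j i / 2)
      = ∑ i ∈ p, ‖a i‖ ^ 2 * ∑ j ∈ p, m i j := by
    simp_rw [Finset.sum_add_distrib]
    rw [Finset.sum_comm (f := fun i j => ‖a j‖ ^ 2 * m j i / 2), ← Finset.sum_add_distrib]
    refine Finset.sum_congr rfl fun i _ => ?_
    rw [Finset.mul_sum, ← Finset.sum_add_distrib]
    exact Finset.sum_congr rfl fun j _ => by ring
  rw [h1]
  refine h2.trans (h3.trans ?_)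
  rw [h4, Finset.mul_sum]
  refine Finset.sum_le_sum fun i _ => ?_
  rw [mul_comm]
  exact mul_le_mul_of_nonneg_right (hK i) (by positivity)

theorem summable_exp_neg_mul_abs {c : ℝ} (hc : 0 < c) :
    Summable fun n : ℤ => Real.exp (-(c * |(n : ℝ)|)) := by
  have h : Summable fun n : ℕ => Real.exp (-(c * (n : ℝ))) := by
    have := Real.summable_exp_nat_mul_iff.2 (neg_neg_of_pos hc)
    refine this.congr fun n => ?_
    congr 1; ring
  refine Summable.of_nat_of_neg ?_ ?_
  · simpa using h
  · simpa using h

theorem UniformlyDiscrete.sum_exp_le {S : Set ℝ} (hS : UniformlyDiscrete S) {c : ℝ} (hc : 0 < c) :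
    ∃ K : ℝ, ∀ (x : ℝ) (p : Finset S), ∑ j ∈ p, Real.exp (-c * |x - j|) ≤ K := by
  obtain ⟨δ, hδ, hsep⟩ := hS
  refine ⟨Real.exp (c * δ) * ∑' n : ℤ, Real.exp (-(c * δ * |(n : ℝ)|)), fun x p => ?_⟩
  -- Separation by `δ` makes this map injective, so the sum is dominated by a two-sided geometric
  -- series, uniformly in `x`.
  set F : S → ℤ := fun j => ⌊((j : ℝ) - x) / δ⌋ with hF
  have hinj : Function.Injective F := by
    intro i j hij
    by_contra hne
    have h1 := hsep i i.2 j j.2 fun h => hne (Subtype.ext h)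
    have h2 := Int.abs_sub_lt_one_of_floor_eq_floor hij
    rw [← sub_div, abs_div, abs_of_pos hδ, div_lt_one hδ] at h2
    have : ((i : ℝ) - x - (j - x)) = i - j := by ring
    rw [this] at h2
    linarith
  have hterm : ∀ j : S, Real.exp (-c * |x - j|)
      ≤ Real.exp (c * δ) * Real.exp (-(c * δ * |(F j : ℝ)|)) := by
    intro j
    rw [← Real.exp_add]
    refine Real.exp_le_exp.2 ?_
    have h1 : |(F j : ℝ)| ≤ |((j : ℝ) - x) / δ| + 1 := by
      have h2 := Int.floor_le (((j : ℝ) - x) / δ)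
      have h3 := (Int.lt_floor_add_one (((j : ℝ) - x) / δ)).le
      have h4 : |(F j : ℝ) - ((j : ℝ) - x) / δ| ≤ 1 := by
        rw [abs_le]; constructor <;> simp only [hF] <;> linarith
      have := abs_sub_abs_le_abs_sub (F j : ℝ) (((j : ℝ) - x) / δ)
      linarith
    rw [abs_div, abs_of_pos hδ, abs_sub_comm] at h1
    have h5 : δ * |(F j : ℝ)| ≤ |x - j| + δ := by
      calc δ * |(F j : ℝ)| ≤ δ * (|x - j| / δ + 1) := by gcongr
        _ = _ := by field_simp
    nlinarith
  calc ∑ j ∈ p, Real.exp (-c * |x - j|)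
      ≤ ∑ j ∈ p, Real.exp (c * δ) * Real.exp (-(c * δ * |(F j : ℝ)|)) :=
        Finset.sum_le_sum fun j _ => hterm j
    _ = Real.exp (c * δ) * ∑ n ∈ p.map ⟨F, hinj⟩, Real.exp (-(c * δ * |(n : ℝ)|)) := by
        rw [Finset.sum_map, Finset.mul_sum]; rfl
    _ ≤ _ := by
        gcongr
        exact (summable_exp_neg_mul_abs (by positivity)).sum_le_tsum _
          fun n _ => (Real.exp_pos _).le

theorem UniformlyDiscrete.summable_smul_expo {S : Set ℝ} (hS : UniformlyDiscrete S) {a : S → ℂ}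
    (ha : Memℓp a 2) : Summable fun j : S => a j • (memLp_expo j).toLp := by
  obtain ⟨K, hK⟩ := hS.sum_exp_le (c := 2 * Real.pi) (by positivity)
  have ha2 : Summable fun j => ‖a j‖ ^ 2 := by
    have := (memℓp_gen_iff (by norm_num)).1 ha
    simpa using this
  have hK0 : 0 ≤ K := by simpa using hK 0 ∅
  have hB : ∀ p : Finset S, ‖∑ j ∈ p, a j • (memLp_expo j).toLp‖ ^ 2
      ≤ Real.pi * K * ∑ j ∈ p, ‖a j‖ ^ 2 := by
    intro p
    refine norm_sum_smul_sq_le _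
      (fun i j : S => Real.pi * Real.exp (-(2 * Real.pi) * |(i : ℝ) - j|)) (fun i j => ?_)
      (fun i j => by rw [abs_sub_comm]) p (fun i => ?_) a
    · rw [inner_expo, Complex.norm_real, Real.norm_of_nonneg (by positivity)]
    · rw [← Finset.mul_sum]
      exact mul_le_mul_of_nonneg_left (hK i p) Real.pi_pos.le
  rw [summable_iff_vanishing_norm] at ha2 ⊢
  intro ε hε
  obtain ⟨s, hs⟩ := ha2 (ε ^ 2 / (Real.pi * K + 1)) (by positivity)
  refine ⟨s, fun t ht => ?_⟩
  have h1 := hs t ht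
  rw [Real.norm_of_nonneg (Finset.sum_nonneg fun i _ => by positivity),
    lt_div_iff₀ (by positivity)] at h1
  have h2 := hB t
  have h3 : 0 ≤ ∑ j ∈ t, ‖a j‖ ^ 2 := Finset.sum_nonneg fun i _ => by positivity
  exact lt_of_pow_lt_pow_left₀ 2 hε.le (by nlinarith)

theorem coeFn_sum_smul_expo {ι : Type*} (φ : ι → ℝ) (a : ι → ℂ) (p : Finset ι) :
    ⇑(∑ j ∈ p, a j • (memLp_expo (φ j)).toLp)
      =ᵐ[cauchyWeight] fun t => ∑ j ∈ p, a j * expo (φ j) t := by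
  classical
  induction p using Finset.induction_on with
  | empty =>
    filter_upwards [Lp.coeFn_zero ℂ 2 cauchyWeight] with t ht
    simpa using ht
  | insert i p hi ih =>
    rw [Finset.sum_insert hi]
    filter_upwards [ih, Lp.coeFn_add (a i • (memLp_expo (φ i)).toLp)
      (∑ j ∈ p, a j • (memLp_expo (φ j)).toLp), Lp.coeFn_smul (a i) (memLp_expo (φ i)).toLp,
      (memLp_expo (φ i)).coeFn_toLp] with t h1 h2 h3 h4
    rw [h2, Pi.add_apply, h1, h3, Pi.smul_apply, h4, smul_eq_mul, Finset.sum_insert hi]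

theorem tendsto_eLpNorm_sub_of_tendsto {ι : Type*} {F : Filter ι} {u : ι → Lp ℂ 2 cauchyWeight}
    {f : Lp ℂ 2 cauchyWeight} (h : Tendsto u F (𝓝 f)) {v : ι → ℝ → ℂ}
    (hv : ∀ i, ⇑(u i) =ᵐ[cauchyWeight] v i) :
    Tendsto (fun i => eLpNorm (fun t => f t - v i t) 2 cauchyWeight) F (𝓝 0) := by
  rw [Lp.tendsto_Lp_iff_tendsto_eLpNorm'] at h
  refine h.congr fun i => ?_
  rw [eLpNorm_sub_comm]
  refine eLpNorm_congr_ae ?_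
  filter_upwards [hv i] with t ht
  rw [Pi.sub_apply, ht]

/-- The same `H` is obtained for both indexings: pairs of finite sets, as in `IsNonharmonicSeries`,
and finite subsets of the sum type, which treats all frequencies as one family in the coefficient
argument. -/
theorem exists_cauchyWeight_limit {L G : Set ℝ} (hL : UniformlyDiscrete L)
    (hG : UniformlyDiscrete G) {a : L → ℂ} {b : G → ℂ} (ha : Memℓp a 2) (hb : Memℓp b 2) :
    ∃ H : ℝ → ℂ, StronglyMeasurable H ∧ MemLp H 2 cauchyWeight ∧
      Tendsto (fun p : Finset L × Finset G =>
        eLpNorm (fun t => H t - partialSum a b p t) 2 cauchyWeight) atTop (𝓝 0) ∧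
      Tendsto (fun p : Finset (L ⊕ G) => eLpNorm (fun t => H t - ∑ i ∈ p,
        Sum.elim a b i * expo (Sum.elim (fun l : L => (l : ℝ)) (fun g : G => (g : ℝ)) i) t)
          2 cauchyWeight) atTop (𝓝 0) := by
  obtain ⟨f, hf⟩ := hL.summable_smul_expo ha
  obtain ⟨g, hg⟩ := hG.summable_smul_expo hb
  refine ⟨⇑(f + g), Lp.stronglyMeasurable _, Lp.memLp _, ?_, ?_⟩
  · have h : Tendsto (fun p : Finset L × Finset G => (∑ l ∈ p.1, a l • (memLp_expo l).toLp)
        + ∑ l ∈ p.2, b l • (memLp_expo l).toLp) atTop (𝓝 (f + g)) := by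
      rw [← prod_atTop_atTop_eq]
      have hf' : Tendsto (fun p : Finset L => ∑ l ∈ p, a l • (memLp_expo l).toLp) atTop (𝓝 f) := hf
      have hg' : Tendsto (fun p : Finset G => ∑ l ∈ p, b l • (memLp_expo l).toLp) atTop (𝓝 g) := hg
      exact (hf'.comp tendsto_fst).add (hg'.comp tendsto_snd)
    refine tendsto_eLpNorm_sub_of_tendsto h fun p => ?_
    filter_upwards [coeFn_sum_smul_expo (fun l : L => (l : ℝ)) a p.1,
      coeFn_sum_smul_expo (fun l : G => (l : ℝ)) b p.2,
      Lp.coeFn_add (∑ l ∈ p.1, a l • (memLp_expo l).toLp)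
        (∑ l ∈ p.2, b l • (memLp_expo l).toLp)] with t h1 h2 h3
    rw [h3, Pi.add_apply, h1, h2, partialSum]
  · have h := HasSum.sum (f := fun i : L ⊕ G => Sum.elim a b i •
      (memLp_expo (Sum.elim (fun l : L => (l : ℝ)) (fun g : G => (g : ℝ)) i)).toLp) hf hg
    exact tendsto_eLpNorm_sub_of_tendsto h fun p => coeFn_sum_smul_expo _ _ p

theorem ae_eq_of_isNonharmonicSeries {L G : Set ℝ} {a : L → ℂ} {b : G → ℂ} {H H' : ℝ → ℂ}
    (h : IsNonharmonicSeries a b H) (h' : IsNonharmonicSeries a b H') : H =ᵐ[volume] H' := by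
  have hps : ∀ p, Continuous (partialSum a b p) := fun p => by
    unfold partialSum
    have := continuous_expo
    fun_prop
  have hR : ∀ R : ℝ, H =ᵐ[volume.restrict (Icc (-R) R)] H' := by
    intro R
    have hsum := (h.2 R).add (h'.2 R)
    rw [add_zero] at hsum
    have hle : eLpNorm (H - H') 2 (volume.restrict (Icc (-R) R)) ≤ 0 := by
      refine ge_of_tendsto' hsum fun p => ?_
      have e : H - H' = (fun t => H t - partialSum a b p t) - fun t => H' t - partialSum a b p t := by
        ext t; simp
      rw [e]
      exact eLpNorm_sub_le ((h.1.restrict).sub (hps p).aestronglyMeasurable)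
        ((h'.1.restrict).sub (hps p).aestronglyMeasurable) (by norm_num)
    have h0 := (eLpNorm_eq_zero_iff ((h.1.restrict).sub (h'.1.restrict)) (by norm_num)).1
      (le_antisymm hle zero_le)
    filter_upwards [h0] with t ht
    exact sub_eq_zero.1 ht
  have hU : (⋃ n : ℕ, Icc (-(n : ℝ)) n) = univ := by
    refine eq_univ_of_forall fun x => mem_iUnion.2 ?_
    obtain ⟨n, hn⟩ := exists_nat_ge |x|
    exact ⟨n, abs_le.1 hn⟩
  rw [← Measure.restrict_univ (μ := volume), ← hU]
  exact (ae_restrict_iUnion_iff _ _).2 fun n => hR n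

theorem isNonharmonicSeries_of_tendsto {L G : Set ℝ} {a : L → ℂ} {b : G → ℂ} {H : ℝ → ℂ}
    (hm : AEStronglyMeasurable H volume)
    (h : Tendsto (fun p : Finset L × Finset G =>
        eLpNorm (fun t => H t - partialSum a b p t) 2 cauchyWeight) atTop (𝓝 0)) :
    IsNonharmonicSeries a b H := by
  refine ⟨hm, fun R => ?_⟩
  have h1 := ENNReal.Tendsto.const_mul (a := ENNReal.ofReal (1 + R ^ 2) ^ (1 / (2 : ℝ≥0∞)).toReal) h
    (Or.inr (ENNReal.rpow_ne_top_of_nonneg (by positivity) ENNReal.ofReal_ne_top))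
  rw [mul_zero] at h1
  exact tendsto_of_tendsto_of_tendsto_of_le_of_le tendsto_const_nhds h1 (fun _ => zero_le)
    fun p => eLpNorm_Icc_le_cauchyWeight R _

/-! ### Dyadic decomposition of `-log w` -/

/-- The dyadic points `2^{-n-1}`. -/
noncomputable def dyad (n : ℕ) : ℝ := (1 / 2) ^ (n + 1)

theorem dyad_pos (n : ℕ) : 0 < dyad n := by unfold dyad; positivity

theorem dyad_antitone : Antitone dyad := fun _ _ h =>
  pow_le_pow_of_le_one (by norm_num) (by norm_num) (by omega)

theorem dyad_zero : dyad 0 = 1 / 2 := by norm_num [dyad]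

theorem dyad_succ (n : ℕ) : dyad (n + 1) = dyad n / 2 := by
  unfold dyad; rw [pow_succ _ (n + 1)]; ring

theorem dyad_le (n : ℕ) : dyad n ≤ 1 / 2 := dyad_zero ▸ dyad_antitone (Nat.zero_le n)

theorem dyad_mem (n : ℕ) : dyad n ∈ Ioo (0 : ℝ) 1 :=
  ⟨dyad_pos n, (dyad_le n).trans_lt (by norm_num)⟩

theorem exists_dyad_le {x : ℝ} (hx : 0 < x) : ∃ N, dyad N ≤ x := by
  obtain ⟨N, hN⟩ := exists_pow_lt_of_lt_one hx (by norm_num : (1 / 2 : ℝ) < 1)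
  refine ⟨N, le_trans ?_ hN.le⟩
  exact pow_le_pow_of_le_one (by norm_num) (by norm_num) (by omega)

/-- The increments of `-log w` along the dyadic points. -/
noncomputable def logStep (w : ℝ → ℝ) (n : ℕ) : ℝ :=
  -Real.log (w (dyad (n + 1))) - -Real.log (w (dyad n))

theorem sum_logStep (w : ℝ → ℝ) (N : ℕ) : ∑ n ∈ Finset.range N, logStep w n
    = -Real.log (w (dyad N)) - -Real.log (w (dyad 0)) :=
  Finset.sum_range_sub (fun n => -Real.log (w (dyad n))) N

namespace DeepZeroWeight

variable {w : ℝ → ℝ}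

theorem neg_log_le (hw : DeepZeroWeight w) {x y : ℝ} (hx : x ∈ Ioo (0 : ℝ) 1)
    (hy : y ∈ Ioo (0 : ℝ) 1) (hxy : x ≤ y) : -Real.log (w y) ≤ -Real.log (w x) :=
  neg_le_neg (Real.log_le_log (hw.pos x hx) (hw.mono hx hy hxy))

theorem logStep_nonneg (hw : DeepZeroWeight w) (n : ℕ) : 0 ≤ logStep w n :=
  sub_nonneg.2 (hw.neg_log_le (dyad_mem _) (dyad_mem _) (dyad_antitone (Nat.le_succ n)))

/-- A step-function majorant: if `dyad (k+1) ≤ x < dyad k`, monotonicity compares `w x` with `w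
(dyad (k+1))`, and the increments telescoping to the latter are those with `x < dyad n`. -/
theorem ofReal_neg_log_le (hw : DeepZeroWeight w) {x : ℝ} (hx : x ∈ Ioo (0 : ℝ) 1) (N : ℕ)
    (hN : dyad N ≤ x) : ENNReal.ofReal (-Real.log (w x)) ≤
      ENNReal.ofReal (-Real.log (w (dyad 0))) + ∑ n ∈ Finset.range N,
        ENNReal.ofReal (logStep w n) * (Ioo 0 (dyad n)).indicator 1 x := by
  induction N with
  | zero => simpa using ENNReal.ofReal_le_ofReal (hw.neg_log_le (dyad_mem 0) hx hN)
  | succ N ih =>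
    rcases le_or_gt (dyad N) x with h | h
    · refine (ih h).trans ?_
      rw [Finset.sum_range_succ, ← add_assoc]
      exact le_self_add
    · have e : ∑ n ∈ Finset.range (N + 1),
          ENNReal.ofReal (logStep w n) * (Ioo 0 (dyad n)).indicator 1 x
          = ENNReal.ofReal (∑ n ∈ Finset.range (N + 1), logStep w n) := by
        rw [ENNReal.ofReal_sum_of_nonneg fun n _ => hw.logStep_nonneg n]
        refine Finset.sum_congr rfl fun n hn => ?_
        have hn' : n ≤ N := by simpa [Nat.lt_succ_iff] using hn
        rw [indicator_of_mem (show x ∈ Ioo 0 (dyad n) from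
          ⟨hx.1, h.trans_le (dyad_antitone hn')⟩), Pi.one_apply, mul_one]
      rw [e, sum_logStep]
      refine le_trans (ENNReal.ofReal_le_ofReal ?_) ENNReal.ofReal_add_le
      have := hw.neg_log_le (dyad_mem (N + 1)) hx hN
      linarith

/-- Integrating the step majorant gives a constant plus `∑ logStep w n * dyad n`, so bounded partial
sums would make the logarithmic integral finite. -/
theorem exists_le_sum_logStep (hw : DeepZeroWeight w) (B : ℝ) :
    ∃ N, B ≤ ∑ n ∈ Finset.range N, logStep w n * dyad n := by
  by_contra! hB
  have hnn : ∀ n, 0 ≤ logStep w n * dyad n := fun n =>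
    mul_nonneg (hw.logStep_nonneg n) (dyad_pos n).le
  have hsum : Summable fun n => logStep w n * dyad n :=
    summable_of_sum_range_le hnn fun N => (hB N).le
  have hle : ∫⁻ t in Ioo (0 : ℝ) 1, ENNReal.ofReal (-Real.log (w t))
      ≤ ∫⁻ t in Ioo (0 : ℝ) 1, (ENNReal.ofReal (-Real.log (w (dyad 0))) + ∑' n,
        ENNReal.ofReal (logStep w n) * (Ioo 0 (dyad n)).indicator 1 t) := by
    refine setLIntegral_mono' measurableSet_Ioo fun x hx => ?_
    obtain ⟨N, hN⟩ := exists_dyad_le hx.1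
    refine (hw.ofReal_neg_log_le hx N hN).trans ?_
    gcongr
    exact ENNReal.sum_le_tsum _
  have hind : ∀ n, Measurable ((Ioo 0 (dyad n)).indicator (1 : ℝ → ℝ≥0∞)) := fun n =>
    measurable_one.indicator measurableSet_Ioo
  rw [hw.log_integral, lintegral_add_left measurable_const, lintegral_tsum
    (fun n => ((hind n).const_mul _).aemeasurable)] at hle
  have hterm : ∀ n, ∫⁻ t in Ioo (0 : ℝ) 1,
      ENNReal.ofReal (logStep w n) * (Ioo 0 (dyad n)).indicator 1 t
        ≤ ENNReal.ofReal (logStep w n * dyad n) := by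
    intro n
    rw [lintegral_const_mul _ (hind n), ENNReal.ofReal_mul (hw.logStep_nonneg n)]
    gcongr
    refine (setLIntegral_le_lintegral _ _).trans ?_
    rw [lintegral_indicator_one measurableSet_Ioo, Real.volume_Ioo, sub_zero]
  have hfin : ∑' n, ENNReal.ofReal (logStep w n * dyad n) ≠ ∞ := by
    rw [← ENNReal.ofReal_tsum_of_nonneg hnn hsum]
    exact ENNReal.ofReal_ne_top
  have hlt : ∫⁻ _ in Ioo (0 : ℝ) 1, ENNReal.ofReal (-Real.log (w (dyad 0))) < ∞ := by
    rw [setLIntegral_const, Real.volume_Ioo]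
    exact ENNReal.mul_lt_top ENNReal.ofReal_lt_top ENNReal.ofReal_lt_top
  exact absurd (hle.trans (add_le_add_right (ENNReal.tsum_le_tsum hterm) _))
    (not_le.2 (ENNReal.add_lt_top.2 ⟨hlt, hfin.lt_top⟩))

/-- The matching minorant: step `n` is counted only for `x < dyad (n+1)`, one dyadic scale lower
than in the majorant, so the telescoped sum stays below the true logarithm. The `max` covers points
where the sum is empty and the logarithm is negative. -/
theorem sum_logStep_indicator_le (hw : DeepZeroWeight w) {x : ℝ} (hx : x ∈ Ioo (0 : ℝ) 1) (N : ℕ) :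
    ∑ n ∈ Finset.range N, logStep w n * (Ioo 0 (dyad (n + 1))).indicator 1 x
      ≤ max 0 (Real.log (w (dyad 0) / w x)) := by
  rw [Real.log_div (hw.pos _ (dyad_mem 0)).ne' (hw.pos x hx).ne']
  induction N with
  | zero => simp
  | succ N ih =>
    rcases le_or_gt (dyad (N + 1)) x with h | h
    · rw [Finset.sum_range_succ, indicator_of_notMem (fun hm => absurd hm.2 (not_lt.2 h)), mul_zero,
        add_zero]
      exact ih
    · have e : ∑ n ∈ Finset.range (N + 1), logStep w n * (Ioo 0 (dyad (n + 1))).indicator 1 x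
          = ∑ n ∈ Finset.range (N + 1), logStep w n := by
        refine Finset.sum_congr rfl fun n hn => ?_
        have hn' : n + 1 ≤ N + 1 := by simpa using hn
        rw [indicator_of_mem (show x ∈ Ioo 0 (dyad (n + 1)) from
          ⟨hx.1, h.trans_le (dyad_antitone hn')⟩), Pi.one_apply, mul_one]
      rw [e, sum_logStep]
      have := hw.neg_log_le hx (dyad_mem (N + 1)) h.le
      exact le_max_of_le_right (by linarith)

theorem sum_bump_nonpos (hw : DeepZeroWeight w) {x : ℝ} (hx : x ∉ Ioo (0 : ℝ) 1) (N : ℕ) :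
    ∑ n ∈ Finset.range N, 3 / 16 * logStep w n * (bump (dyad (n + 1) / 4) x).re ≤ 0 := by
  refine Finset.sum_nonpos fun n _ => mul_nonpos_of_nonneg_of_nonpos
    (mul_nonneg (by norm_num) (hw.logStep_nonneg n))
    (bump_re_nonpos (div_pos (dyad_pos _) (by norm_num)) ?_)
  rcases le_or_gt x 0 with h | h
  · exact Or.inl h
  · right
    have h1 : 1 ≤ x := by by_contra! h2; exact hx ⟨h, h2⟩
    have := dyad_le (n + 1)
    linarith

/-- The normalisations fit together: bump `n` is positive on `(0, dyad (n+1))` and at most `8/3`,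
`3/16 · 8/3 = 1/2`, and squaring restores the full increment. -/
theorem exp_two_mul_sum_bump_le (hw : DeepZeroWeight w) {x : ℝ} (hx : x ∈ Ioo (0 : ℝ) 1) (N : ℕ) :
    Real.exp (∑ n ∈ Finset.range N, 3 / 16 * logStep w n * (bump (dyad (n + 1) / 4) x).re) ^ 2
      ≤ 1 + w (dyad 0) / w x := by
  have h1 : ∑ n ∈ Finset.range N, 3 / 16 * logStep w n * (bump (dyad (n + 1) / 4) x).re
      ≤ 1 / 2 * ∑ n ∈ Finset.range N, logStep w n * (Ioo 0 (dyad (n + 1))).indicator 1 x := by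
    rw [Finset.mul_sum]
    refine Finset.sum_le_sum fun n _ => ?_
    have hs : 0 < dyad (n + 1) / 4 := div_pos (dyad_pos _) (by norm_num)
    have hl := hw.logStep_nonneg n
    by_cases hm : x ∈ Ioo 0 (dyad (n + 1))
    · rw [indicator_of_mem hm, Pi.one_apply]
      have := mul_le_mul_of_nonneg_left (bump_re_le hs x) hl
      linarith
    · rw [indicator_of_notMem hm, mul_zero, mul_zero]
      refine mul_nonpos_of_nonneg_of_nonpos (by positivity) (bump_re_nonpos hs (Or.inr ?_))
      by_contra! h2
      exact hm ⟨hx.1, by linarith⟩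
  have h2 := hw.sum_logStep_indicator_le hx N
  have hpos : 0 < w (dyad 0) / w x := div_pos (hw.pos _ (dyad_mem 0)) (hw.pos x hx)
  rw [← Real.exp_nat_mul]
  calc _ ≤ Real.exp (max 0 (Real.log (w (dyad 0) / w x))) :=
        Real.exp_le_exp.2 (by push_cast; linarith)
    _ ≤ _ := by
      rcases max_cases 0 (Real.log (w (dyad 0) / w x)) with ⟨h, -⟩ | ⟨h, -⟩ <;> rw [h]
      · rw [Real.exp_zero]; linarith
      · rw [Real.exp_log hpos]; linarith

end DeepZeroWeight

/-! ### Upper bounds for the pairing -/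

theorem cauchyWeight_le_volume : cauchyWeight ≤ volume := by
  conv_rhs => rw [← withDensity_one (μ := (volume : Measure ℝ))]
  refine withDensity_mono (Eventually.of_forall fun x => ?_)
  rw [Pi.one_apply, ← ENNReal.ofReal_one]
  refine ENNReal.ofReal_le_ofReal ?_
  rw [div_le_one (by positivity)]
  nlinarith [sq_nonneg x]

/-- From `u ≤ 1 + u²` with `u = |H|E`, where `E² ≤ 1` off `(0,1)` and `E² ≤ 1 + w(1/2)/w` on it. The
essential point is that the bound does not depend on `N`. -/
theorem lintegral_enorm_mul_exp_sum_bump_le {w : ℝ → ℝ} (hw : DeepZeroWeight w) {H : ℝ → ℂ}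
    (hH : AEStronglyMeasurable H cauchyWeight) (N : ℕ) :
    ∫⁻ x, ‖H x‖ₑ * ENNReal.ofReal (Real.exp (∑ n ∈ Finset.range N,
        3 / 16 * logStep w n * (bump (dyad (n + 1) / 4) x).re)) ∂cauchyWeight
      ≤ cauchyWeight univ + ∫⁻ x, ‖H x‖ₑ ^ 2 ∂cauchyWeight
        + ENNReal.ofReal (w (dyad 0))
          * ∫⁻ t in Ioo (0 : ℝ) 1, ENNReal.ofReal (‖H t‖ ^ 2 / w t) := by
  set E : ℝ → ℝ := fun x => Real.exp (∑ n ∈ Finset.range N,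
    3 / 16 * logStep w n * (bump (dyad (n + 1) / 4) x).re) with hE
  have hpt : ∀ x, ‖H x‖ₑ * ENNReal.ofReal (E x) ≤ (1 + ‖H x‖ₑ ^ 2)
      + (Ioo (0 : ℝ) 1).indicator
        (fun t => ENNReal.ofReal (w (dyad 0)) * ENNReal.ofReal (‖H t‖ ^ 2 / w t)) x := by
    intro x
    have hE0 : 0 ≤ E x := (Real.exp_pos _).le
    rw [← ofReal_norm, ← ENNReal.ofReal_mul (norm_nonneg _),
      ← ENNReal.ofReal_pow (norm_nonneg _), ← ENNReal.ofReal_one,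
      ← ENNReal.ofReal_add zero_le_one (by positivity)]
    have h1 : ‖H x‖ * E x ≤ 1 + ‖H x‖ ^ 2 * E x ^ 2 := by
      nlinarith [sq_nonneg (‖H x‖ * E x - 1), sq_nonneg (‖H x‖ * E x)]
    by_cases hx : x ∈ Ioo (0 : ℝ) 1
    · have hw0 := (hw.pos _ (dyad_mem 0)).le
      have hwx := hw.pos x hx
      rw [indicator_of_mem hx, ← ENNReal.ofReal_mul hw0,
        ← ENNReal.ofReal_add (by positivity) (by positivity)]
      refine ENNReal.ofReal_le_ofReal (h1.trans ?_)
      have h2 := mul_le_mul_of_nonneg_left (hw.exp_two_mul_sum_bump_le hx N) (sq_nonneg ‖H x‖)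
      calc 1 + ‖H x‖ ^ 2 * E x ^ 2 ≤ 1 + ‖H x‖ ^ 2 * (1 + w (dyad 0) / w x) := by
            gcongr 1 + ?_
        _ = _ := by ring
    · rw [indicator_of_notMem hx, add_zero]
      refine ENNReal.ofReal_le_ofReal (h1.trans ?_)
      have h2 : E x ≤ 1 := Real.exp_le_one_iff.2 (hw.sum_bump_nonpos hx N)
      have h3 : E x ^ 2 ≤ 1 := pow_le_one₀ hE0 h2
      nlinarith [sq_nonneg ‖H x‖]
  refine (lintegral_mono hpt).trans ?_
  rw [lintegral_add_left' (by fun_prop), lintegral_add_left measurable_const, lintegral_const,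
    one_mul]
  gcongr
  rw [lintegral_indicator measurableSet_Ioo, lintegral_const_mul' _ _ ENNReal.ofReal_ne_top]
  gcongr
  exact cauchyWeight_le_volume

/-- Used for the error `H - S` of a partial sum: the constant may grow with `N`, since the partial
sums converge while `N` is fixed. -/
theorem lintegral_enorm_mul_exp_le {g : ℝ → ℝ} {B : ℝ} (hg : ∀ x, g x ≤ B) {f : ℝ → ℂ}
    (hf : AEStronglyMeasurable f cauchyWeight) :
    ∫⁻ x, ‖f x‖ₑ * ENNReal.ofReal (Real.exp (g x)) ∂cauchyWeight
      ≤ ENNReal.ofReal (Real.exp B) * cauchyWeight univ ^ ((1 : ℝ) / 2)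
        * eLpNorm f 2 cauchyWeight := by
  have h1 := eLpNorm_le_eLpNorm_mul_rpow_measure_univ (p := 1) (q := 2) (by norm_num) hf
  rw [eLpNorm_one_eq_lintegral_enorm] at h1
  calc _ ≤ ∫⁻ x, ENNReal.ofReal (Real.exp B) * ‖f x‖ₑ ∂cauchyWeight := by
        refine lintegral_mono fun x => ?_
        rw [mul_comm]
        gcongr
        exact hg x
    _ = ENNReal.ofReal (Real.exp B) * ∫⁻ x, ‖f x‖ₑ ∂cauchyWeight :=
        lintegral_const_mul' _ _ ENNReal.ofReal_ne_top
    _ ≤ ENNReal.ofReal (Real.exp B) * (eLpNorm f 2 cauchyWeight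
        * cauchyWeight univ ^ ((1 : ℝ) / 2)) := by
        gcongr
        refine h1.trans (le_of_eq ?_)
        norm_num
    _ = _ := by ring

/-! ### The surviving exponential sum -/

theorem list_prod_one_sub_eq_zero {μ : ℝ} {l : List ℝ} (hμ : μ ∈ l) (h0 : μ ≠ 0) :
    (l.map fun γ : ℝ => (1 - μ / γ : ℂ)).prod = 0 := by
  refine List.prod_eq_zero (List.mem_map.2 ⟨μ, hμ, ?_⟩)
  rw [div_self (by exact_mod_cast h0), sub_self]

/-- With `u = √(|μ|/γ)` one has `1 + u² ≤ (1+u)² ≤ e^{2u}` and `2√|μ| ≤ 1 + |μ|`. The exponent is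
linear in `|μ|` uniformly over lists with bounded `∑ γ^{-1/2}`, so `e^{2πμY}` beats it for large
`Y`. -/
theorem norm_list_prod_one_sub_le {μ : ℝ} (hμ : μ ≤ 0) (l : List ℝ) (hl : ∀ γ ∈ l, 0 < γ) :
    ‖(l.map fun γ : ℝ => (1 - μ / γ : ℂ)).prod‖
      ≤ Real.exp ((1 + |μ|) * (l.map fun γ => 1 / √γ).sum) := by
  induction l with
  | nil => simp
  | cons γ l ih =>
    have hγ : 0 < γ := hl γ (by simp)
    have ih' := ih fun d hd => hl d (by simp [hd])
    simp only [List.map_cons, List.prod_cons, List.sum_cons]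
    rw [norm_mul, mul_add, Real.exp_add]
    have h1 : ‖(1 - μ / γ : ℂ)‖ ≤ Real.exp ((1 + |μ|) * (1 / √γ)) := by
      have e : (1 - μ / γ : ℂ) = ((1 + |μ| / γ : ℝ) : ℂ) := by
        rw [abs_of_nonpos hμ]; push_cast; ring
      rw [e, Complex.norm_real, Real.norm_of_nonneg (by positivity)]
      have hs := Real.sqrt_pos.2 hγ
      set u := √|μ| / √γ with hu
      have hu0 : 0 ≤ u := by positivity
      have hu2 : |μ| / γ = u ^ 2 := by
        rw [hu, div_pow, Real.sq_sqrt (abs_nonneg _), Real.sq_sqrt hγ.le]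
      have h2 : 1 + u ^ 2 ≤ Real.exp (2 * u) := by
        have h3 : (1 + u) ^ 2 ≤ Real.exp u ^ 2 := by
          have := Real.add_one_le_exp u
          gcongr
          linarith
        rw [← Real.exp_nat_mul] at h3
        push_cast at h3
        nlinarith
      rw [hu2]
      refine h2.trans (Real.exp_le_exp.2 ?_)
      have h4 : 2 * √|μ| ≤ 1 + |μ| := by
        nlinarith [sq_nonneg (√|μ| - 1), Real.sq_sqrt (abs_nonneg μ)]
      rw [hu, mul_one_div, ← mul_div_assoc]
      gcongr
    gcongr

/-- The positive frequencies with indices in `p`. -/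
noncomputable def posFreqs {I : Type*} (φ : I → ℝ) (p : Finset I) : List ℝ :=
  (p.filter fun i => 0 < φ i).toList.map φ

theorem mem_posFreqs {I : Type*} {φ : I → ℝ} {p : Finset I} {γ : ℝ} :
    γ ∈ posFreqs φ p ↔ ∃ i ∈ p, 0 < φ i ∧ φ i = γ := by
  simp [posFreqs, and_assoc]

theorem posFreqs_pos {I : Type*} (φ : I → ℝ) (p : Finset I) : ∀ γ ∈ posFreqs φ p, 0 < γ := by
  intro γ hγ
  obtain ⟨i, -, hi, rfl⟩ := mem_posFreqs.1 hγ
  exact hi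

theorem sum_map_posFreqs_le {I : Type*} (φ : I → ℝ) (p : Finset I) {f : ℝ → ℝ}
    (hf : ∀ x, 0 ≤ f x) (hs : Summable fun i => f (φ i)) :
    ((posFreqs φ p).map f).sum ≤ ∑' i, f (φ i) := by
  rw [posFreqs, List.map_map, Finset.sum_map_toList]
  exact hs.sum_le_tsum _ fun i _ => hf _

/-- The exponential sum over the nonpositive frequencies that survives the annihilation of the
positive ones, evaluated at `-iY`. -/
noncomputable def survivor {I : Type*} (φ : I → ℝ) (a : I → ℂ) (p : Finset I) (Y : ℝ) : ℂ :=
  ∑ i ∈ p.filter fun i => φ i ≤ 0,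
    a i * (((posFreqs φ p).map fun γ : ℝ => (1 - φ i / γ : ℂ)).prod
      * Real.exp (2 * Real.pi * φ i * Y))

theorem integral_sum_mul_annih {I : Type*} (φ : I → ℝ) (a : I → ℂ) (p : Finset I) {h : ℂ → ℂ}
    (hh : BddHalfPlane h) {Y : ℝ} (hY : 0 < Y) :
    ∫ x : ℝ, (∑ i ∈ p, a i * expo (φ i) x)
        * annih (posFreqs φ p) (fun z => h z / (z ^ 2 + (Y : ℂ) ^ 2)) x
      = Real.pi / Y * h (-(Y * Complex.I)) * survivor φ a p Y := by
  obtain ⟨η, hη, hstrip⟩ := hh.stripDecay hY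
  obtain ⟨η', hη', hstrip'⟩ := hstrip.annih hη (posFreqs φ p)
  have hint := hstrip'.integrable hη'
  simp_rw [Finset.sum_mul, mul_assoc]
  rw [integral_finsetSum _ fun i _ => (integrable_expo_mul hint (φ i)).const_mul (a i)]
  simp_rw [integral_const_mul, integral_expo_mul_annih hη hstrip _ _ (posFreqs_pos φ p)]
  rw [survivor, Finset.mul_sum, Finset.mul_sum, Finset.sum_filter]
  refine Finset.sum_congr rfl fun i hi => ?_
  split_ifs with hφ
  · rw [integral_expo_mul_div hh hY hφ]
    ring
  · have hφ' := not_le.1 hφ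
    rw [list_prod_one_sub_eq_zero (mem_posFreqs.2 ⟨i, hi, hφ', rfl⟩) hφ'.ne', zero_mul, mul_zero]

/-- Both sides estimate the pairing of the partial sum `S` with the test function: from below by the
exact formula and the size of the outer factor at `-iY`, from above by splitting `S = H - (H - S)`.
The first term is bounded independently of `N` and `p`; the second vanishes as `p` grows with `N`
fixed. -/
theorem enorm_survivor_le {I : Type*} (φ : I → ℝ) (a : I → ℂ) {σ : ℝ}
    (hσ : ∀ p : Finset I, ((posFreqs φ p).map fun γ => √(1 / (2 * Real.pi * γ))).sum ≤ σ)
    {H : ℝ → ℂ} (hH : MemLp H 2 cauchyWeight) {w : ℝ → ℝ} (hw : DeepZeroWeight w) {N : ℕ} {A Y : ℝ}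
    (hA0 : 0 < A) (hA : A = 60 * ∑ n ∈ Finset.range N, 3 / 16 * logStep w n * (dyad (n + 1) / 4))
    (hAσ : 20 * σ ≤ √A) (hY : 1 ≤ Y) (p : Finset I) :
    ENNReal.ofReal (Real.pi / Y * Real.exp (A / 60 / (4 * Y) - 10 * (√A * σ) / Y)
        * ‖survivor φ a p Y‖)
      ≤ 4 * (cauchyWeight univ + ∫⁻ x, ‖H x‖ₑ ^ 2 ∂cauchyWeight + ENNReal.ofReal (w (dyad 0))
          * ∫⁻ t in Ioo (0 : ℝ) 1, ENNReal.ofReal (‖H t‖ ^ 2 / w t))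
        + 4 * (ENNReal.ofReal (Real.exp (∑ n ∈ Finset.range N, 3 / 16 * logStep w n * (8 / 3)))
          * cauchyWeight univ ^ ((1 : ℝ) / 2)
          * eLpNorm (fun t => H t - ∑ i ∈ p, a i * expo (φ i) t) 2 cauchyWeight) := by
  have hY0 : 0 < Y := by linarith
  set c : ℕ → ℝ := fun n => 3 / 16 * logStep w n with hc
  set s : ℕ → ℝ := fun n => dyad (n + 1) / 4 with hs
  have hc0 : ∀ n, 0 ≤ c n := fun n => mul_nonneg (by norm_num) (hw.logStep_nonneg n)
  have hs0 : ∀ n, 0 < s n := fun n => div_pos (dyad_pos _) (by norm_num)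
  have hsY : ∀ n, s n ≤ Y := fun n => by
    have := dyad_le (n + 1)
    simp only [hs]; linarith
  set l := posFreqs φ p with hl
  have hl0 : ∀ γ ∈ l, 0 < γ := posFreqs_pos φ p
  set S : ℝ → ℂ := fun t => ∑ i ∈ p, a i * expo (φ i) t with hS
  have hScont : Continuous S := by
    have := continuous_expo
    simp only [hS]; fun_prop
  set T : ℝ → ℂ := fun x => annih l
    (fun z => outerFactor N c s A l z / (z ^ 2 + (Y : ℂ) ^ 2)) x with hT
  set g : ℝ → ℝ := fun x => ∑ n ∈ Finset.range N, c n * (bump (s n) x).re with hg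
  have hgm : Measurable g := by
    refine Finset.measurable_fun_sum _ fun n _ => Measurable.const_mul ?_ _
    simp only [bump_re_ofReal (hs0 n)]
    fun_prop
  have hgB : ∀ x, g x ≤ ∑ n ∈ Finset.range N, c n * (8 / 3) := fun x =>
    Finset.sum_le_sum fun n _ => mul_le_mul_of_nonneg_left (bump_re_le (hs0 n) x) (hc0 n)
  have hTb : ∀ᵐ x : ℝ, ‖T x‖ₑ ≤ ENNReal.ofReal (1 / (1 + x ^ 2))
      * (4 * ENNReal.ofReal (Real.exp (g x))) := by
    have : ∀ᵐ x : ℝ, x ≠ 0 := by simp [ae_iff]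
    filter_upwards [this] with x hx
    have h1 := norm_annih_outerFactor_le N hc0 hs0 hA0 hl0 hY0 (hσ p) hA.ge hAσ hx
    rw [← ofReal_norm, show (4 : ℝ≥0∞) = ENNReal.ofReal 4 by norm_num,
      ← ENNReal.ofReal_mul (by norm_num), ← ENNReal.ofReal_mul (by positivity)]
    refine ENNReal.ofReal_le_ofReal (h1.trans ?_)
    rw [← mul_div_assoc, one_div_mul_eq_div]
    have : 1 + x ^ 2 ≤ x ^ 2 + Y ^ 2 := by nlinarith
    gcongr
  have hHm := hH.1
  have hdiff : AEStronglyMeasurable (fun t => H t - S t) cauchyWeight :=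
    hHm.sub hScont.aestronglyMeasurable
  have hmain : ‖∫ x, S x * T x‖ₑ ≤
      4 * (∫⁻ x, ‖H x‖ₑ * ENNReal.ofReal (Real.exp (g x)) ∂cauchyWeight)
      + 4 * ∫⁻ x, ‖H x - S x‖ₑ * ENNReal.ofReal (Real.exp (g x)) ∂cauchyWeight := by
    refine (enorm_integral_le_lintegral_enorm _).trans ?_
    have hSm : AEMeasurable (fun x => ‖S x‖ₑ * (4 * ENNReal.ofReal (Real.exp (g x)))) volume := by
      have := hScont.measurable
      fun_prop
    calc ∫⁻ x, ‖S x * T x‖ₑ ≤ ∫⁻ x, ENNReal.ofReal (1 / (1 + x ^ 2))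
          * (‖S x‖ₑ * (4 * ENNReal.ofReal (Real.exp (g x)))) := by
          refine lintegral_mono_ae ?_
          filter_upwards [hTb] with x hx
          rw [enorm_mul, mul_left_comm]
          gcongr
      _ = ∫⁻ x, ‖S x‖ₑ * (4 * ENNReal.ofReal (Real.exp (g x))) ∂cauchyWeight := by
          rw [cauchyWeight, lintegral_withDensity_eq_lintegral_mul₀
            measurable_cauchyDensity.aemeasurable hSm]
          rfl
      _ ≤ ∫⁻ x, (4 * (‖H x‖ₑ * ENNReal.ofReal (Real.exp (g x)))
          + 4 * (‖H x - S x‖ₑ * ENNReal.ofReal (Real.exp (g x)))) ∂cauchyWeight := by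
          refine lintegral_mono fun x => ?_
          have h1 : ‖S x‖ₑ ≤ ‖H x‖ₑ + ‖H x - S x‖ₑ := by
            have : S x = H x - (H x - S x) := by ring
            conv_lhs => rw [this]
            exact enorm_sub_le
          calc _ ≤ (‖H x‖ₑ + ‖H x - S x‖ₑ) * (4 * ENNReal.ofReal (Real.exp (g x))) := by gcongr
            _ = _ := by ring
      _ = _ := by
          rw [lintegral_add_left' (by fun_prop), lintegral_const_mul' _ _ (by norm_num),
            lintegral_const_mul' _ _ (by norm_num)]
  have hint := integral_sum_mul_annih φ a p
    (bddHalfPlane_outerFactor N (c := c) hs0 hA0 hl0) hY0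
  have hlow := norm_outerFactor_neg_I N hc0 hs0 hA0 hl0 hY0 hsY (hσ p)
  have hC : ∑ n ∈ Finset.range N, c n * s n = A / 60 := by rw [hA]; ring
  rw [hC] at hlow
  have hleft : ENNReal.ofReal (Real.pi / Y * Real.exp (A / 60 / (4 * Y) - 10 * (√A * σ) / Y)
      * ‖survivor φ a p Y‖) ≤ ‖∫ x, S x * T x‖ₑ := by
    rw [show (∫ x, S x * T x) = _ from hint, ← ofReal_norm]
    refine ENNReal.ofReal_le_ofReal ?_
    rw [norm_mul, norm_mul, norm_div, Complex.norm_real, Complex.norm_real,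
      Real.norm_of_nonneg Real.pi_pos.le, Real.norm_of_nonneg hY0.le]
    gcongr
  refine hleft.trans (hmain.trans ?_)
  gcongr
  · exact lintegral_enorm_mul_exp_sum_bump_le hw hHm N
  · exact lintegral_enorm_mul_exp_le hgB hdiff

/-- Dominated convergence: once `2πY ≥ τ + 1`, each term is at most `e^τ ‖a i‖ e^{-|φ i|}`. -/
theorem tendsto_tsum_exp_neg {I : Type*} (φ : I → ℝ) (a : I → ℂ) (τ : ℝ)
    (habs : Summable fun i => ‖a i‖ * Real.exp (-|φ i|)) :
    Tendsto (fun Y : ℝ => ∑' i, if φ i < 0 then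
      ‖a i‖ * Real.exp ((1 + |φ i|) * τ - 2 * Real.pi * |φ i| * Y) else 0) atTop (𝓝 0) := by
  have h := tendsto_tsum_of_dominated_convergence (𝓕 := atTop) (f := fun (Y : ℝ) i =>
      if φ i < 0 then ‖a i‖ * Real.exp ((1 + |φ i|) * τ - 2 * Real.pi * |φ i| * Y) else 0)
    (g := fun _ => 0) (habs.mul_left (Real.exp τ)) ?_ ?_
  · simpa using h
  · intro i
    split_ifs with hi
    · have h0 : 0 < 2 * Real.pi * |φ i| := mul_pos (by positivity) (abs_pos.2 hi.ne)
      have h1 : Tendsto (fun Y : ℝ => (1 + |φ i|) * τ - 2 * Real.pi * |φ i| * Y) atTop atBot := by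
        simp_rw [sub_eq_add_neg]
        exact tendsto_atBot_add_const_left _ _
          (tendsto_neg_atTop_atBot.comp (tendsto_id.const_mul_atTop h0))
      simpa using (Real.tendsto_exp_atBot.comp h1).const_mul ‖a i‖
    · exact tendsto_const_nhds
  · filter_upwards [eventually_ge_atTop ((τ + 1) / (2 * Real.pi))] with Y hY i
    rw [div_le_iff₀ (by positivity)] at hY
    split_ifs with hi
    · rw [Real.norm_of_nonneg (by positivity), mul_left_comm, ← Real.exp_add]
      gcongr
      nlinarith [mul_le_mul_of_nonneg_right hY (abs_nonneg (φ i))]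
    · rw [norm_zero]; positivity

/-- At frequency 0 the product `∏ (1 - μ/γ)` equals 1, so `a i₀` appears unchanged in the survivor.
The remaining terms are bounded independently of `p`, which lets `Y` be chosen before `p` and `N`.
-/
theorem norm_le_norm_survivor_add {I : Type*} (φ : I → ℝ) (a : I → ℂ) {i₀ : I} (h0 : φ i₀ = 0)
    (hinj : ∀ i, φ i = 0 → i = i₀) {τ : ℝ}
    (hτ : ∀ p : Finset I, ((posFreqs φ p).map fun γ => 1 / √γ).sum ≤ τ) {Y : ℝ}
    (hs : Summable fun i => if φ i < 0 then
      ‖a i‖ * Real.exp ((1 + |φ i|) * τ - 2 * Real.pi * |φ i| * Y) else 0)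
    {p : Finset I} (hp : i₀ ∈ p) :
    ‖a i₀‖ ≤ ‖survivor φ a p Y‖ + ∑' i, if φ i < 0 then
      ‖a i‖ * Real.exp ((1 + |φ i|) * τ - 2 * Real.pi * |φ i| * Y) else 0 := by
  classical
  have hmem : i₀ ∈ p.filter fun i => φ i ≤ 0 := by simp [hp, h0]
  rw [survivor, ← Finset.add_sum_erase _ _ hmem]
  have hterm : a i₀ * (((posFreqs φ p).map fun γ : ℝ => (1 - φ i₀ / γ : ℂ)).prod
      * Real.exp (2 * Real.pi * φ i₀ * Y)) = a i₀ := by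
    simp [h0]
  rw [hterm]
  set rest := ∑ i ∈ (p.filter fun i => φ i ≤ 0).erase i₀,
    a i * (((posFreqs φ p).map fun γ : ℝ => (1 - φ i / γ : ℂ)).prod
      * Real.exp (2 * Real.pi * φ i * Y)) with hrest
  have hrb : ‖rest‖ ≤ ∑' i, if φ i < 0 then
      ‖a i‖ * Real.exp ((1 + |φ i|) * τ - 2 * Real.pi * |φ i| * Y) else 0 := by
    refine le_trans (norm_sum_le_of_le _ fun i hi => ?_)
      (hs.sum_le_tsum ((p.filter fun i => φ i ≤ 0).erase i₀) fun i _ => by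
        split_ifs <;> positivity)
    rw [Finset.mem_erase, Finset.mem_filter] at hi
    have hneg : φ i < 0 := lt_of_le_of_ne hi.2.2 fun h => hi.1 (hinj i h)
    rw [if_pos hneg, norm_mul, norm_mul, Complex.norm_real, Real.norm_of_nonneg (Real.exp_pos _).le,
      sub_eq_add_neg, Real.exp_add]
    have h1 := norm_list_prod_one_sub_le hneg.le _ (posFreqs_pos φ p)
    have h2 : (1 + |φ i|) * ((posFreqs φ p).map fun γ => 1 / √γ).sum ≤ (1 + |φ i|) * τ :=
      mul_le_mul_of_nonneg_left (hτ p) (by positivity)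
    have h3 : 2 * Real.pi * φ i * Y = -(2 * Real.pi * |φ i| * Y) := by
      rw [abs_of_neg hneg]; ring
    rw [h3]
    gcongr
    exact h1.trans (Real.exp_le_exp.2 h2)
  calc ‖a i₀‖ = ‖(a i₀ + rest) - rest‖ := by rw [add_sub_cancel_right]
    _ ≤ ‖a i₀ + rest‖ + ‖rest‖ := norm_sub_le _ _
    _ ≤ _ := by gcongr

/-! ### Vanishing of the coefficient at frequency zero -/

theorem coeff_eq_zero_of_freq_zero {I : Type*} (φ : I → ℝ) (a : I → ℂ) {i₀ : I} (h0 : φ i₀ = 0)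
    (hinj : ∀ i, φ i = 0 → i = i₀) (hsum : Summable fun i => 1 / √(φ i))
    (habs : Summable fun i => ‖a i‖ * Real.exp (-|φ i|)) {H : ℝ → ℂ} (hH : MemLp H 2 cauchyWeight)
    (hconv : Tendsto (fun p : Finset I =>
      eLpNorm (fun t => H t - ∑ i ∈ p, a i * expo (φ i) t) 2 cauchyWeight) atTop (𝓝 0))
    {w : ℝ → ℝ} (hw : DeepZeroWeight w) (hHw : MemWeightedL2 w H) : a i₀ = 0 := by
  by_contra ha
  have ha0 : 0 < ‖a i₀‖ := norm_pos_iff.2 ha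
  -- The root of a nonpositive real is 0 and `1 / 0 = 0`, so only positive frequencies contribute
  -- here and to `σ`.
  set τ := ∑' i, 1 / √(φ i) with hτdef
  have hτ : ∀ p : Finset I, ((posFreqs φ p).map fun γ => 1 / √γ).sum ≤ τ := fun p =>
    sum_map_posFreqs_le φ p (fun x => by positivity) hsum
  have hsum' : Summable fun i => √(1 / (2 * Real.pi * φ i)) := by
    refine (hsum.mul_left (1 / √(2 * Real.pi))).congr fun i => ?_
    rw [Real.sqrt_div zero_le_one, Real.sqrt_mul (by positivity : 0 ≤ 2 * Real.pi) (φ i),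
      Real.sqrt_one]
    ring
  set σ := ∑' i, √(1 / (2 * Real.pi * φ i)) with hσdef
  have hσ : ∀ p : Finset I, ((posFreqs φ p).map fun γ => √(1 / (2 * Real.pi * γ))).sum ≤ σ :=
    fun p => sum_map_posFreqs_le φ p (f := fun γ => √(1 / (2 * Real.pi * γ)))
      (fun x => Real.sqrt_nonneg _) hsum'
  have hσ0 : 0 ≤ σ := tsum_nonneg fun i => Real.sqrt_nonneg _
  obtain ⟨Y, hYτ, hY1, hYsmall⟩ := ((eventually_ge_atTop ((τ + 1) / (2 * Real.pi))).and
    ((eventually_ge_atTop (1 : ℝ)).and ((tendsto_tsum_exp_neg φ a τ habs).eventually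
      (gt_mem_nhds (half_pos ha0))))).exists
  have hY0 : 0 < Y := by linarith
  have hsY : Summable fun i => if φ i < 0 then
      ‖a i‖ * Real.exp ((1 + |φ i|) * τ - 2 * Real.pi * |φ i| * Y) else 0 := by
    rw [div_le_iff₀ (by positivity)] at hYτ
    refine Summable.of_nonneg_of_le (fun i => by split_ifs <;> positivity) (fun i => ?_)
      (habs.mul_left (Real.exp τ))
    split_ifs with hi
    · rw [mul_left_comm, ← Real.exp_add]
      gcongr
      nlinarith [mul_le_mul_of_nonneg_right hYτ (abs_nonneg (φ i))]
    · positivity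
  set K : ℝ≥0∞ := 4 * (cauchyWeight univ + ∫⁻ x, ‖H x‖ₑ ^ 2 ∂cauchyWeight
    + ENNReal.ofReal (w (dyad 0)) * ∫⁻ t in Ioo (0 : ℝ) 1, ENNReal.ofReal (‖H t‖ ^ 2 / w t)) with hK
  have hKtop : K ≠ ∞ := by
    have h1 : ∫⁻ x, ‖H x‖ₑ ^ 2 ∂cauchyWeight ≠ ∞ := by
      have := lintegral_rpow_enorm_lt_top_of_eLpNorm_lt_top (by norm_num) (by norm_num) hH.2
      simpa using this.ne
    have h2 : ∫⁻ t in Ioo (0 : ℝ) 1, ENNReal.ofReal (‖H t‖ ^ 2 / w t) ≠ ∞ := hHw.ne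
    exact ENNReal.mul_ne_top (by norm_num) (ENNReal.add_ne_top.2
      ⟨ENNReal.add_ne_top.2 ⟨measure_ne_top _ _, h1⟩, ENNReal.mul_ne_top ENNReal.ofReal_ne_top h2⟩)
  -- Here `N` is fixed and `p` grows, which removes the error term; the choice of `Y` leaves at
  -- least half of `‖a i₀‖` in the survivor.
  have hbound : ∀ (N : ℕ) (A : ℝ), 0 < A →
      A = 60 * ∑ n ∈ Finset.range N, 3 / 16 * logStep w n * (dyad (n + 1) / 4) → 20 * σ ≤ √A →
      Real.pi / Y * Real.exp (A / 60 / (4 * Y) - 10 * (√A * σ) / Y) * (‖a i₀‖ / 2) ≤ K.toReal := by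
    intro N A hA0 hA hAσ
    rw [← ENNReal.ofReal_le_iff_le_toReal hKtop]
    have hlim := (ENNReal.Tendsto.const_mul (a := 4) (ENNReal.Tendsto.const_mul
      (a := ENNReal.ofReal (Real.exp (∑ n ∈ Finset.range N, 3 / 16 * logStep w n * (8 / 3)))
          * cauchyWeight univ ^ ((1 : ℝ) / 2)) hconv (Or.inr (ENNReal.mul_ne_top
            ENNReal.ofReal_ne_top (ENNReal.rpow_ne_top_of_nonneg (by norm_num)
              (measure_ne_top _ _))))) (Or.inr (by norm_num))).const_add K
    rw [mul_zero, mul_zero, add_zero] at hlim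
    refine ge_of_tendsto hlim ?_
    filter_upwards [eventually_ge_atTop ({i₀} : Finset I)] with p hp
    refine le_trans (ENNReal.ofReal_le_ofReal ?_)
      (enorm_survivor_le φ a hσ hH hw hA0 hA hAσ hY1 p)
    have := norm_le_norm_survivor_add φ a h0 hinj hτ hsY (hp (Finset.mem_singleton_self i₀))
    gcongr
    linarith
  -- The gain in the exponent is `A/(240Y)`. Once `√A ≥ 4800σ` the damping loss `10√Aσ/Y` is at most
  -- `A/(480Y)`, leaving `A/(480Y)`; the constant 10000 is a generous choice that also yields `20σ ≤
  -- √A`.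
  obtain ⟨B, hB1, hB2, hB3⟩ : ∃ B : ℝ, 1 ≤ B ∧ (10000 * σ) ^ 2 ≤ B ∧
      K.toReal < Real.pi / Y * (B / (480 * Y)) * (‖a i₀‖ / 2) := by
    have h : Tendsto (fun B : ℝ => Real.pi / Y * (B / (480 * Y)) * (‖a i₀‖ / 2)) atTop atTop := by
      have hpos : 0 < Real.pi / Y * (1 / (480 * Y)) * (‖a i₀‖ / 2) := by positivity
      refine (tendsto_id.const_mul_atTop hpos).congr fun B => ?_
      simp only [id]; ring
    exact ((eventually_ge_atTop 1).and ((eventually_ge_atTop _).and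
      (h.eventually (eventually_gt_atTop K.toReal)))).exists
  obtain ⟨N, hN⟩ := hw.exists_le_sum_logStep B
  set A := 60 * ∑ n ∈ Finset.range N, 3 / 16 * logStep w n * (dyad (n + 1) / 4) with hA
  have hAB : B ≤ A := by
    have e : A = 45 / 32 * ∑ n ∈ Finset.range N, logStep w n * dyad n := by
      rw [hA, Finset.mul_sum, Finset.mul_sum]
      refine Finset.sum_congr rfl fun n _ => ?_
      rw [dyad_succ]; ring
    rw [e]; linarith
  have hA0 : 0 < A := by linarith
  have hsq : 10000 * σ ≤ √A := Real.le_sqrt_of_sq_le (hB2.trans hAB)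
  have hfin := hbound N A hA0 hA (by linarith)
  have hexp : B / (480 * Y) ≤ Real.exp (A / 60 / (4 * Y) - 10 * (√A * σ) / Y) := by
    have h1 : √A * √A = A := Real.mul_self_sqrt hA0.le
    have h2 : 10 * (√A * σ) ≤ A / 480 := by nlinarith [Real.sqrt_nonneg A]
    have h3 : A / 60 / (4 * Y) - 10 * (√A * σ) / Y = (A / 240 - 10 * (√A * σ)) / Y := by
      ring
    have h4 : B / (480 * Y) ≤ (A / 240 - 10 * (√A * σ)) / Y := by
      rw [← div_div]
      gcongr
      linarith
    rw [h3]
    linarith [Real.add_one_le_exp ((A / 240 - 10 * (√A * σ)) / Y)]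
  have : Real.pi / Y * (B / (480 * Y)) * (‖a i₀‖ / 2)
      ≤ Real.pi / Y * Real.exp (A / 60 / (4 * Y) - 10 * (√A * σ) / Y) * (‖a i₀‖ / 2) := by
    gcongr
  linarith

/-! ### Translation of frequencies and conclusion -/

theorem UniformlyDiscrete.summable_exp_neg {S : Set ℝ} (hS : UniformlyDiscrete S) (ν : ℝ) :
    Summable fun j : S => Real.exp (-|(j : ℝ) - ν|) := by
  obtain ⟨K, hK⟩ := hS.sum_exp_le one_pos
  refine summable_of_sum_le (c := K) (fun _ => (Real.exp_pos _).le) fun p => ?_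
  refine le_trans (le_of_eq ?_) (hK ν p)
  refine Finset.sum_congr rfl fun j _ => ?_
  rw [abs_sub_comm, neg_one_mul]

theorem UniformlyDiscrete.eventually_lt_abs {S : Set ℝ} (hS : UniformlyDiscrete S) (B : ℝ) :
    ∀ᶠ j : S in cofinite, B < |(j : ℝ)| := by
  have h := (hS.summable_exp_neg 0).tendsto_cofinite_zero.eventually
    (gt_mem_nhds (Real.exp_pos (-B)))
  filter_upwards [h] with j hj
  have := Real.exp_lt_exp.1 hj
  rw [sub_zero] at this
  linarith

/-- Translation makes only finitely many points of `L` positive, and the others contribute 0 by the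
convention for `√`. For `g > 2|ν|` one has `g - ν ≥ g/2`, which gives the comparison on `G`. -/
theorem summable_one_div_sqrt_sub {L G : Set ℝ} (hL : L ⊆ Iic 0) (hG : G ⊆ Ioi 0)
    (hLud : UniformlyDiscrete L) (hGud : UniformlyDiscrete G)
    (hsum : Summable fun g : G => 1 / √(g : ℝ)) (ν : ℝ) :
    Summable fun i : L ⊕ G =>
      1 / √(Sum.elim (fun l : L => (l : ℝ)) (fun g : G => (g : ℝ)) i - ν) := by
  have h1 : Summable fun l : L => 1 / √((l : ℝ) - ν) := by
    refine Summable.of_norm_bounded_eventually (g := fun _ => 0) summable_zero ?_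
    filter_upwards [hLud.eventually_lt_abs |ν|] with l hl
    have hl0 : (l : ℝ) ≤ 0 := hL l.2
    rw [abs_of_nonpos hl0] at hl
    have := neg_abs_le ν
    rw [Real.sqrt_eq_zero_of_nonpos (by linarith)]
    simp
  have h2 : Summable fun g : G => 1 / √((g : ℝ) - ν) := by
    refine Summable.of_norm_bounded_eventually (hsum.mul_left √2) ?_
    filter_upwards [hGud.eventually_lt_abs (2 * |ν|)] with g hg
    have hg0 : (0 : ℝ) < g := hG g.2
    rw [abs_of_pos hg0] at hg
    have := le_abs_self ν
    rw [Real.norm_of_nonneg (by positivity)]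
    have h3 : √((g : ℝ) / 2) ≤ √((g : ℝ) - ν) := Real.sqrt_le_sqrt (by linarith)
    calc 1 / √((g : ℝ) - ν) ≤ 1 / √((g : ℝ) / 2) := by
          have : 0 < √((g : ℝ) / 2) := Real.sqrt_pos.2 (by positivity)
          gcongr
      _ = √2 * (1 / √(g : ℝ)) := by
          rw [Real.sqrt_div hg0.le, one_div_div, mul_one_div]
  exact (h1.hasSum.sum (f := fun i : L ⊕ G =>
    1 / √(Sum.elim (fun l : L => (l : ℝ)) (fun g : G => (g : ℝ)) i - ν)) h2.hasSum).summable

theorem summable_norm_mul_exp_neg {S : Set ℝ} (hS : UniformlyDiscrete S) {a : S → ℂ}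
    (ha : Memℓp a 2) (ν : ℝ) : Summable fun j : S => ‖a j‖ * Real.exp (-|(j : ℝ) - ν|) := by
  have ha2 : Summable fun j => ‖a j‖ ^ 2 := by
    have := (memℓp_gen_iff (by norm_num)).1 ha
    simpa using this
  refine Summable.of_nonneg_of_le (fun j => by positivity) (fun j => ?_)
    (ha2.add (hS.summable_exp_neg ν))
  have h0 := Real.exp_pos (-|(j : ℝ) - ν|)
  have h1 : Real.exp (-|(j : ℝ) - ν|) ≤ 1 := Real.exp_le_one_iff.2 (neg_nonpos.2 (abs_nonneg _))
  nlinarith [sq_nonneg (‖a j‖ - Real.exp (-|(j : ℝ) - ν|)), sq_nonneg ‖a j‖, norm_nonneg (a j)]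

theorem coeff_eq_zero {L G : Set ℝ} (hL : L ⊆ Iic 0) (hG : G ⊆ Ioi 0)
    (hLud : UniformlyDiscrete L) (hGud : UniformlyDiscrete G)
    (hsum : Summable fun g : G => 1 / √(g : ℝ)) {a : L → ℂ} {b : G → ℂ} (ha : Memℓp a 2)
    (hb : Memℓp b 2) {H : ℝ → ℂ} (hH : MemLp H 2 cauchyWeight)
    (hconv : Tendsto (fun p : Finset (L ⊕ G) => eLpNorm (fun t => H t - ∑ i ∈ p,
        Sum.elim a b i * expo (Sum.elim (fun l : L => (l : ℝ)) (fun g : G => (g : ℝ)) i) t)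
          2 cauchyWeight) atTop (𝓝 0))
    {w : ℝ → ℝ} (hw : DeepZeroWeight w) (hHw : MemWeightedL2 w H) (i₀ : L ⊕ G) :
    Sum.elim a b i₀ = 0 := by
  set ψ : L ⊕ G → ℝ := Sum.elim (fun l : L => (l : ℝ)) (fun g : G => (g : ℝ)) with hψ
  have hinj : Function.Injective ψ := by
    rintro (l | g) (l' | g') h <;> simp only [hψ, Sum.elim_inl, Sum.elim_inr] at h
    · rw [Subtype.ext h]
    · have h1 : (l : ℝ) ≤ 0 := hL l.2
      have h2 : (0 : ℝ) < g' := hG g'.2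
      linarith
    · have h1 : (l' : ℝ) ≤ 0 := hL l'.2
      have h2 : (0 : ℝ) < g := hG g.2
      linarith
    · rw [Subtype.ext h]
  have hnorm : ∀ t, ‖H t * expo (-ψ i₀) t‖ = ‖H t‖ := fun t => by rw [norm_mul, norm_expo, mul_one]
  refine coeff_eq_zero_of_freq_zero (fun i => ψ i - ψ i₀) (Sum.elim a b) (i₀ := i₀) (sub_self _)
    (fun i hi => hinj (sub_eq_zero.1 hi))
    (summable_one_div_sqrt_sub hL hG hLud hGud hsum (ψ i₀)) ?_
    (H := fun t => H t * expo (-ψ i₀) t) ?_ ?_ hw ?_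
  · exact ((summable_norm_mul_exp_neg hLud ha (ψ i₀)).hasSum.sum
      (f := fun i : L ⊕ G => ‖Sum.elim a b i‖ * Real.exp (-|ψ i - ψ i₀|))
      (summable_norm_mul_exp_neg hGud hb (ψ i₀)).hasSum).summable
  · exact (memLp_congr_norm (hH.1.mul (continuous_expo _).aestronglyMeasurable) hH.1
      (Eventually.of_forall hnorm)).2 hH
  · refine hconv.congr fun p => eLpNorm_congr_norm_ae (Eventually.of_forall fun t => ?_)
    have e : H t * expo (-ψ i₀) t - ∑ i ∈ p, Sum.elim a b i * expo (ψ i - ψ i₀) t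
        = (H t - ∑ i ∈ p, Sum.elim a b i * expo (ψ i) t) * expo (-ψ i₀) t := by
      rw [sub_mul, Finset.sum_mul]
      congr 1
      refine Finset.sum_congr rfl fun i _ => ?_
      rw [mul_assoc, expo_mul, sub_eq_add_neg]
    simp only [e, norm_mul, norm_expo, mul_one]
  · unfold MemWeightedL2
    simp only [hnorm]
    exact hHw

theorem theorem3 (L G : Set ℝ) (hL : L ⊆ Iic 0) (hG : G ⊆ Ioi 0)
    (hLud : UniformlyDiscrete L) (hGud : UniformlyDiscrete G)
    (hsum : Summable fun g : G => 1 / Real.sqrt (g : ℝ))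
    (a : L → ℂ) (b : G → ℂ) (ha : Memℓp a 2) (hb : Memℓp b 2) :
    (∃ H : ℝ → ℂ, IsNonharmonicSeries a b H) ∧
    ∀ H : ℝ → ℂ, IsNonharmonicSeries a b H →
      ∀ w : ℝ → ℝ, DeepZeroWeight w → MemWeightedL2 w H →
        H =ᵐ[volume] 0 ∧ (∀ l, a l = 0) ∧ (∀ g, b g = 0) := by
  obtain ⟨H₀, hm, hmem, hlim, hlim'⟩ := exists_cauchyWeight_limit hLud hGud ha hb
  have hH₀ := isNonharmonicSeries_of_tendsto hm.aestronglyMeasurable hlim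
  refine ⟨⟨H₀, hH₀⟩, fun H hH w hw hHw => ?_⟩
  have hae := ae_eq_of_isNonharmonicSeries hH hH₀
  have hw₀ : MemWeightedL2 w H₀ := by
    unfold MemWeightedL2 at hHw ⊢
    refine lt_of_eq_of_lt (lintegral_congr_ae ?_) hHw
    filter_upwards [ae_restrict_of_ae hae] with t ht
    rw [ht]
  have hcoeff := coeff_eq_zero hL hG hLud hGud hsum ha hb hmem hlim' hw hw₀
  have ha0 : ∀ l, a l = 0 := fun l => hcoeff (Sum.inl l)
  have hb0 : ∀ g, b g = 0 := fun g => hcoeff (Sum.inr g)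
  -- With all coefficients zero, the zero function is also a sum of the series, and uniqueness of
  -- the sum identifies it with `H`.
  have hzero : IsNonharmonicSeries a b (0 : ℝ → ℂ) := by
    refine ⟨aestronglyMeasurable_zero, fun R => ?_⟩
    simp [partialSum, ha0, hb0]
  exact ⟨ae_eq_of_isNonharmonicSeries hH hzero, ha0, hb0⟩
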